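/- Let $\mathbb{F}_q$ be a finite field with $q$ elements, $k=\mathbb{F}_q(\theta)$ the rational function field, $L/k$ a finite extension, and $t$ a new variable. Let $M_L$ be the set of places of $L$, and for $v\in M_L$ let $\mathrm{ord}_v$ be the additive valuation with $\mathrm{ord}_v(L^\times)=\mathbb{Z}$ and $\deg(v)$ the degree over $\mathbb{F}_q$ of the residue field of $v$. A divisor is a finite sum $D=\sum_v D_v\cdot v$ with $D_v\in\mathbb{Z}$; its degree is $\deg(D)=\sum_v D_v\deg(v)$, its Riemann–Roch space is $\mathcal{L}(D)=\{x\in L : \mathrm{ord}_v(x)+D_v\ge 0\text{ for all }v\in M_L\}$, and it is effective if all $D_v\ge 0$; moreover $D\vee D'=\sum_v\max\{D_v,D'_v\}\cdot v$. For $0\ne x=(x_1,\dots,x_n)\in L^n$, $n\ge 1$, put $\mathrm{div}(x)=\sum_v\min_i\mathrm{ord}_v(x_i)\cdot v$ and $h(x)=-\deg(\mathrm{div}(x))/[L:k]$. Let $L[\tau]$ be the twisted polynomial ring with $\tau\alpha=\alpha^q\tau$ for $\alpha\in L$; an element $\sum_n c_n\tau^n$ acts on $L$ by $x\mapsto\sum_n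 c_nx^{q^n}$. A Drinfeld $\mathbb{F}_q[t]$-module $E$ over $L$ is an $\mathbb{F}_q$-algebra homomorphism $\phi:\mathbb{F}_q[t]\to L[\tau]$, $a\mapsto\phi_a$, whose image is not contained in $L$, with $\phi_t=\theta+\kappa_1\tau+\cdots+\kappa_r\tau^r$, $\kappa_r\neq 0$; we write $E(L)=L$ for its points. An $L$-isomorphism $u:E\to E'$ is an element $u\in L[\tau]$ with $u\phi_t=\phi'_tu$ that has a two-sided inverse $u'\in L[\tau]$ with $u'\phi'_t=\phi_tu'$. For $v\in M_L$ let $S_v$ be the slope of the rightmost edge of the Newton polygon at $v$ of $(t-\theta)x+\kappa_1x^q+\cdots+\kappa_rx^{q^r}\in L[t][x]$, that is, of the lower convex hull of the points $(1,\min\{0,\mathrm{ord}_v(\theta)\})$ and $(q^j,\mathrm{ord}_v(\kappa_j))$ for $1\le j\le r$ with $\kappa_j\ne 0$. Put $\mathrm{div}(E_{\mathrm{slope}})=\sum_v\lceil S_v\rceil\cdot v$. **Theorem.** Let $E$ be a Drinfeld $\mathbb{F}_q[t]$-module over $L$, let $\ell\ge 1$, and let $P_1,\dots,P_\ell\in E(L)$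 be distinct and non-zero. Put $$G=\Big\{(a_1,\dots,a_\ell)\in\mathbb{F}_q[t]^\ell : \sum_{i=1}^\ell\phi_{a_i}(P_i)=0\Big\},\qquad D=\big(-\mathrm{div}(P_1,\dots,P_\ell)\big)\vee\mathrm{div}(E_{\mathrm{slope}}).$$ Then $\mathrm{div}(P_1,\dots,P_\ell)$, $\mathrm{div}(E_{\mathrm{slope}})$ and $D$ are divisors (only finitely many coefficients are non-zero), $d=\dim_{\mathbb{F}_q}\mathcal{L}(D)$ is finite, and the following hold. 1. There are finitely many vectors $\mathbf{m}_1,\dots,\mathbf{m}_\nu\in G$ with $G=\mathrm{Span}_{\mathbb{F}_q[t]}\{\mathbf{m}_1,\dots,\mathbf{m}_\nu\}$ such that every entry of every $\mathbf{m}_i$ has degree at most $d+\ell$ in $t$. 2. $\deg(D)\ge[L:k]\cdot h(P_1,\dots,P_\ell)$, with equality if $-\big(\mathrm{div}(P_1,\dots,P_\ell)+\mathrm{div}(E_{\mathrm{slope}})\big)$ is effective. 3. If $E'$ is a Drinfeld $\mathbb{F}_q[t]$-module over $L$ and $u:E\to E'$ is an $L$-isomorphism, then $D'=\big(-\mathrm{div}(u(P_1),\dots,u(P_\ell))\big)\vee\mathrm{div}(E'_{\mathrm{slope}})$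 is a divisor and $\deg(D')=\deg(D)$. -/

import Mathlib

noncomputable section

namespace Drinfeld

open Polynomial

/-! ### Places and divisors of a field `L` over a constant field `F` -/

section Places

variable (F L : Type*) [Field F] [Field L] [Algebra F L]

/-- A place of `L` over `F`, given by its valuation ring: a discrete valuation ring with fraction
field `L` that contains `F`. -/
@[ext]
structure Place where
  ring : ValuationSubring L
  algebraMap_mem : ∀ c : F, algebraMap F L c ∈ ring
  dvr : IsDiscreteValuationRing ring

variable {F L}

namespace Place

instance (v : Place F L) : IsDiscreteValuationRing v.ring := v.dvr

instance (v : Place F L) : Algebra F v.ring :=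
  ((algebraMap F L).codRestrict v.ring v.algebraMap_mem).toAlgebra

/-- The normalized multiplicative valuation of `L` attached to `v`. -/
def val (v : Place F L) : Valuation L (WithZero (Multiplicative ℤ)) :=
  (IsDiscreteValuationRing.maximalIdeal v.ring).valuation L

open Classical in
/-- The normalized additive valuation `ord_v` (a uniformizer has order `1`), with `ord_v 0 = ⊤`. -/
def ord (v : Place F L) (x : L) : WithTop ℤ :=
  if x = 0 then ⊤ else ((-(WithZero.log (v.val x)) : ℤ) : WithTop ℤ)

/-- The degree of a place: the degree over `F` of its residue field. -/
def degree (v : Place F L) : ℕ := Module.finrank F (IsLocalRing.ResidueField v.ring)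

/-- `ord_v` of a vector: the minimum of the orders of its entries. -/
def ordVec (v : Place F L) {n : ℕ} (x : Fin n → L) : WithTop ℤ :=
  Finset.univ.inf fun i => v.ord (x i)

/-- `ord_v` of a polynomial with coefficients in `L`: the minimum of the orders of its
coefficients. -/
def ordPoly (v : Place F L) (h : L[X]) : WithTop ℤ :=
  h.support.inf fun i => v.ord (h.coeff i)

theorem le_ord_iff (v : Place F L) (n : ℤ) (x : L) :
    (n : WithTop ℤ) ≤ v.ord x ↔ v.val x ≤ WithZero.exp (-n) := by
  by_cases hx : x = 0
  · simp [ord, hx]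
  · have h0 : v.val x ≠ 0 := (Valuation.ne_zero_iff _).2 hx
    rw [ord, if_neg hx, WithTop.coe_le_coe, le_neg, WithZero.log_le_iff_le_exp h0]

theorem val_algebraMap_le (v : Place F L) (c : F) : v.val (algebraMap F L c) ≤ 1 :=
  (IsDiscreteValuationRing.maximalIdeal v.ring).valuation_le_one (K := L)
    ⟨algebraMap F L c, v.algebraMap_mem c⟩

end Place

/-- A formal `ℤ`-linear combination of places, given by its coefficients. It is a divisor when
its support is finite. -/
abbrev FormalDivisor (F L : Type*) [Field F] [Field L] [Algebra F L] : Type _ := Place F L → ℤ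

/-- The divisor `∑ ord_v(x) · v` of a vector `x ≠ 0`. -/
def divVec {n : ℕ} (x : Fin n → L) : FormalDivisor F L := fun v => (v.ordVec x).untopD 0

/-- The degree `∑ D_v · deg v` of a divisor. -/
def deg (D : FormalDivisor F L) : ℤ := ∑ᶠ v : Place F L, D v * (v.degree : ℤ)

/-- The Riemann–Roch space `𝓛(D) = {x ∈ L | ord_v(x) + D_v ≥ 0 for all v}` (it contains `0`). -/
def riemannRochSpace (D : FormalDivisor F L) : Submodule F L where
  carrier := {x | ∀ v : Place F L, ((-(D v) : ℤ) : WithTop ℤ) ≤ v.ord x}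
  zero_mem' := fun v => by simp [Place.ord]
  add_mem' := fun {x y} hx hy v => by
    rw [Place.le_ord_iff]
    exact Valuation.map_add_le _ ((v.le_ord_iff _ _).1 (hx v)) ((v.le_ord_iff _ _).1 (hy v))
  smul_mem' := fun c x hx v => by
    rw [Place.le_ord_iff, Algebra.smul_def, map_mul]
    exact le_trans (mul_le_of_le_one_left' (v.val_algebraMap_le c)) ((v.le_ord_iff _ _).1 (hx v))

/-- The slope of the rightmost edge of the Newton polygon at `v` of a polynomial `f` with
coefficients in `L[t]`, i.e. of the lower convex hull of the points `(n, ord_v(f_n))`, `f_n ≠ 0`: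
the largest slope of a segment that joins one of the other points to the last point. The value
is `0` if there is only one point. -/
def lastSlope (v : Place F L) (f : L[X][X]) : ℚ :=
  if h : (f.support.erase f.natDegree).Nonempty then
    (f.support.erase f.natDegree).sup' h fun n =>
      (((v.ordPoly (f.coeff f.natDegree)).untopD 0 - (v.ordPoly (f.coeff n)).untopD 0 : ℤ) : ℚ)
        / ((f.natDegree : ℚ) - (n : ℚ))
  else 0

/-- The line of slope `lastSlope v f` through the last point of the Newton polygon lies below all
the points of the polygon and passes through another one, so that it carries the last edge. -/
theorem lastSlope_spec (v : Place F L) (f : L[X][X])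
    (h : (f.support.erase f.natDegree).Nonempty) :
    (∀ n ∈ f.support, (((v.ordPoly (f.coeff f.natDegree)).untopD 0 : ℤ) : ℚ)
        - lastSlope v f * ((f.natDegree : ℚ) - (n : ℚ)) ≤ ((v.ordPoly (f.coeff n)).untopD 0 : ℤ)) ∧
    ∃ n ∈ f.support, n < f.natDegree ∧ (((v.ordPoly (f.coeff f.natDegree)).untopD 0 : ℤ) : ℚ)
        - lastSlope v f * ((f.natDegree : ℚ) - (n : ℚ)) = ((v.ordPoly (f.coeff n)).untopD 0 : ℤ) := by
  have key : ∀ n ∈ f.support.erase f.natDegree, n < f.natDegree := fun n hn =>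
    lt_of_le_of_ne (le_natDegree_of_mem_supp n (Finset.mem_of_mem_erase hn))
      (Finset.ne_of_mem_erase hn)
  rw [lastSlope, dif_pos h]
  refine ⟨fun n hn => ?_, ?_⟩
  · by_cases hd : n = f.natDegree
    · subst hd; simp
    · have hm : n ∈ f.support.erase f.natDegree := Finset.mem_erase.2 ⟨hd, hn⟩
      have hpos : (0 : ℚ) < (f.natDegree : ℚ) - (n : ℚ) := by
        have := key n hm
        rw [sub_pos]; exact_mod_cast this
      have h1 := Finset.le_sup' (fun n =>
        (((v.ordPoly (f.coeff f.natDegree)).untopD 0 - (v.ordPoly (f.coeff n)).untopD 0 : ℤ) : ℚ)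
        / ((f.natDegree : ℚ) - (n : ℚ))) hm
      rw [div_le_iff₀ hpos] at h1
      push_cast at h1 ⊢
      linarith
  · obtain ⟨n, hn, he⟩ := Finset.exists_mem_eq_sup' h (fun n =>
        (((v.ordPoly (f.coeff f.natDegree)).untopD 0 - (v.ordPoly (f.coeff n)).untopD 0 : ℤ) : ℚ)
        / ((f.natDegree : ℚ) - (n : ℚ)))
    refine ⟨n, Finset.mem_of_mem_erase hn, key n hn, ?_⟩
    have hpos : (0 : ℚ) < (f.natDegree : ℚ) - (n : ℚ) := by
      have := key n hn
      rw [sub_pos]; exact_mod_cast this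
    rw [he, div_mul_cancel₀ _ hpos.ne']
    push_cast
    ring

end Places

/-! ### Twisted polynomials and Drinfeld modules -/

section Twisted

variable (F L : Type*) [Field F] [Fintype F] [Field L] [Algebra F L]

/-- The action of `ℕ` on `L` in which `n` acts as `x ↦ x ^ (q ^ n)`, where `q = #F`. -/
@[reducible]
def frobeniusAction : MulSemiringAction (Multiplicative ℕ) L :=
  MulSemiringAction.compHom L
    (powersHom (L →+* L) (FiniteField.frobeniusAlgHom F L : L →+* L))

theorem frobeniusAction_smul (n : ℕ) (x : L) :
    (frobeniusAction F L).smul (Multiplicative.ofAdd n) x = x ^ (Fintype.card F ^ n) := by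
  change ((FiniteField.frobeniusAlgHom F L : L →+* L) ^ n) x = _
  induction n with
  | zero => simp
  | succ n ih =>
    rw [pow_succ', RingHom.mul_def, RingHom.comp_apply, ih, pow_succ, pow_mul]
    simp

/-- The twisted polynomial ring `L[τ]`, in which `τ α = α ^ q τ`, where `q = #F`. -/
@[nolint unusedArguments]
def TwistedPoly (F L : Type*) [Field F] [Fintype F] [Field L] [Algebra F L] : Type _ :=
  SkewPolynomial L

namespace TwistedPoly

instance : Ring (TwistedPoly F L) :=
  @SkewMonoidAlgebra.instRing L (Multiplicative ℕ) _ _ (frobeniusAction F L)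

/-- The inclusion `L → L[τ]` of the constants. -/
def C : L →+* TwistedPoly F L :=
  @SkewPolynomial.CRingHom L _ (frobeniusAction F L)

theorem C_commutes (c : F) (u : TwistedPoly F L) :
    C F L (algebraMap F L c) * u = u * C F L (algebraMap F L c) := by
  let := frobeniusAction F L
  have : SMulCommClass (Multiplicative ℕ) F L := ⟨fun m c x => by
    change (frobeniusAction F L).smul (Multiplicative.ofAdd m.toAdd) (c • x)
      = c • (frobeniusAction F L).smul (Multiplicative.ofAdd m.toAdd) x
    rw [frobeniusAction_smul, frobeniusAction_smul, _root_.smul_pow, FiniteField.pow_card_pow]⟩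
  exact Algebra.commutes (A := SkewPolynomial L) c u

instance : Algebra F (TwistedPoly F L) :=
  RingHom.toAlgebra' ((C F L).comp (algebraMap F L)) (C_commutes F L)

variable {F L}

/-- The coefficient of `τ ^ n`. -/
def coeff (u : TwistedPoly F L) (n : ℕ) : L := SkewPolynomial.coeff (R := L) u n

/-- The degree in `τ` (with value `0` for the zero polynomial). -/
def natDegree (u : TwistedPoly F L) : ℕ := (SkewPolynomial.support (R := L) u).sup id

/-- `u = ∑ c_n τ ^ n` acts on `L` as `x ↦ ∑ c_n x ^ (q ^ n)`. -/
def eval (u : TwistedPoly F L) (x : L) : L :=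
  SkewPolynomial.sum (R := L) u fun n c => c * x ^ (Fintype.card F ^ n)

end TwistedPoly

end Twisted

section DrinfeldModules

variable (F L : Type*) [Field F] [Fintype F] [Field L] [Algebra F L] [Algebra (RatFunc F) L]

/-- The image `θ` in `L` of the variable of the rational function field `F(θ)`. -/
def theta : L := algebraMap (RatFunc F) L RatFunc.X

/-- A Drinfeld `F[t]`-module over the extension `L` of `F(θ)`: an `F`-algebra homomorphism
`φ : F[t] → L[τ]` with `φ_t = θ + κ₁ τ + ⋯ + κ_r τ ^ r`, whose image is not contained in `L`. -/
structure DrinfeldModule where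
  φ : F[X] →ₐ[F] TwistedPoly F L
  coeff_zero : (φ X).coeff 0 = theta F L
  not_const : ¬ ∀ a : F[X], ∀ n : ℕ, 0 < n → (φ a).coeff n = 0

namespace DrinfeldModule

variable {F L}

/-- The rank `r = deg_τ φ_t`. -/
def rank (E : DrinfeldModule F L) : ℕ := (E.φ X).natDegree

/-- The coefficient `κ_j` of `τ ^ j` in `φ_t`. -/
def κ (E : DrinfeldModule F L) (j : ℕ) : L := (E.φ X).coeff j

/-- The action `φ_a(P)` of `a ∈ F[t]` on a point `P ∈ E(L) = L`. -/
def act (E : DrinfeldModule F L) (a : F[X]) (P : L) : L := (E.φ a).eval P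

/-- The polynomial `(t - θ) x + κ₁ x ^ q + ⋯ + κ_r x ^ (q ^ r)` with coefficients in `L[t]`. -/
def assocPoly (E : DrinfeldModule F L) : L[X][X] :=
  C (X - C (theta F L)) * X
    + ∑ j ∈ Finset.Icc 1 E.rank, C (C (E.κ j)) * X ^ (Fintype.card F ^ j)

/-- The divisor `div(E_slope) = ∑ ⌈S_v⌉ · v`, where `S_v` is the slope of the last edge of the
Newton polygon at `v` of `(t - θ) x + κ₁ x ^ q + ⋯ + κ_r x ^ (q ^ r)`. -/
def divSlope (E : DrinfeldModule F L) : FormalDivisor F L := fun v => ⌈lastSlope v E.assocPoly⌉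

/-- The divisor `(-div(P_1, …, P_ℓ)) ∨ div(E_slope)`. -/
def boundDivisor (E : DrinfeldModule F L) {ℓ : ℕ} (P : Fin ℓ → L) : FormalDivisor F L :=
  (-divVec P) ⊔ E.divSlope

/-- The relations `{a ∈ F[t]^ℓ | ∑ φ_{a_i}(P_i) = 0}`. -/
def relations (E : DrinfeldModule F L) {ℓ : ℕ} (P : Fin ℓ → L) : Set (Fin ℓ → F[X]) :=
  {a | ∑ i, E.act (a i) (P i) = 0}

/-- `u ∈ L[τ]` is a morphism `E → E'` if `u φ_t = φ'_t u`. -/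
def IsMorphism (E E' : DrinfeldModule F L) (u : TwistedPoly F L) : Prop :=
  u * E.φ X = E'.φ X * u

/-- `u ∈ L[τ]` is an `L`-isomorphism `E → E'`: a morphism with an inverse morphism. -/
def IsIsomorphism (E E' : DrinfeldModule F L) (u : TwistedPoly F L) : Prop :=
  IsMorphism E E' u ∧ ∃ u' : TwistedPoly F L, IsMorphism E' E u' ∧ u * u' = 1 ∧ u' * u = 1

end DrinfeldModule

/-- The height `h(x) = -deg(div(x)) / [L : F(θ)]` of a vector `x ≠ 0`. -/
def height {L : Type*} [Field L] [Algebra F L] [Algebra (RatFunc F) L] {n : ℕ}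
    (x : Fin n → L) : ℚ :=
  -(deg (divVec x : FormalDivisor F L) : ℚ) / (Module.finrank (RatFunc F) L : ℚ)

end DrinfeldModules

end Drinfeld

end

noncomputable section

namespace Drinfeld

open Polynomial

/-! ### Places: valuations, orders and weak approximation -/

namespace Place

variable {F L : Type*} [Field F] [Field L] [Algebra F L]

/-! The relations are the kernel of `ev a = ∑ φ_{a_i}(P_i)`, under which multiplication by `t`
becomes the operator `φ_t` on `L`. The space `V = 𝓛(D)` has two properties. It contains every `P_i`,
because `D ≥ -div(P)`. It also contains every `x` with `φ_t(x) ∈ V`, because `D ≥ div(E_slope)`: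
where the pole order of `x` exceeds the last slope, the top term of `φ_t(x)` dominates strictly and
the pole grows (`val_lt_val_act_X`). Writing `a = t a' + a(0)`, it follows that `ev a ∈ V` forces
`ev a' ∈ V`.

The rest of the first claim is linear algebra (`mem_span_of_ev_eq_zero`). The subspaces of `V`
formed by the values of vectors of degree `< j` stop growing at `j = d = dim V`. In a relation `a`
of larger degree, `a'` can therefore be replaced by some `b` of degree `< d` with the same value.
Then `t b + a(0)` is a relation of degree at most `d`, and `a` differs from it by `t` times the
relation `a' - b`, whose degree is smaller. This gives the bound `d`, which is stronger than `d +
ℓ`.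

The second claim is monotonicity of the degree. For the third, an isomorphism is a constant `c ≠ 0`,
and it replaces `D` by `D - div(c)`; the product formula gives equality of degrees.

The facts on function fields (finiteness of zeros and poles, the product formula, finite dimension
of `𝓛(D)`) come from counting. Enlarging a divisor by `v` multiplies the size of a space of
functions by at most `q ^ deg v`, and by exactly that over finitely many places. Comparison with `[L
: F(y)]` bounds the zeros of `y` above and its poles below. -/

theorem val_coe_le_one (v : Place F L) (a : v.ring) : v.val (a : L) ≤ 1 :=
  (IsDiscreteValuationRing.maximalIdeal v.ring).valuation_le_one (K := L) a

theorem val_coe_lt_one_iff (v : Place F L) (a : v.ring) :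
    v.val (a : L) < 1 ↔ a ∈ IsLocalRing.maximalIdeal v.ring :=
  (IsDiscreteValuationRing.maximalIdeal v.ring).valuation_lt_one_iff_mem (K := L) a

theorem val_le_one_iff (v : Place F L) (x : L) : v.val x ≤ 1 ↔ x ∈ v.ring := by
  refine ⟨fun h => ?_, fun h => v.val_coe_le_one ⟨x, h⟩⟩
  by_contra hx
  have hx0 : x ≠ 0 := fun h0 => hx (h0 ▸ v.ring.zero_mem)
  have hi : x⁻¹ ∈ v.ring := (v.ring.mem_or_inv_mem x).resolve_left hx
  have hlt : v.val x⁻¹ < 1 := by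
    refine (v.val_coe_lt_one_iff ⟨x⁻¹, hi⟩).2 ?_
    rw [IsLocalRing.mem_maximalIdeal, mem_nonunits_iff]
    intro hu
    obtain ⟨b, hb⟩ := hu.exists_right_inv
    have hb' : x⁻¹ * (b : L) = 1 := congrArg Subtype.val hb
    apply hx
    have : x = (b : L) := by
      field_simp at hb'
      exact hb'.symm
    rw [this]
    exact b.2
  rw [map_inv₀] at hlt
  have h0 : 0 < v.val x := zero_lt_iff.2 ((Valuation.ne_zero_iff _).2 hx0)
  exact absurd h (not_le.2 ((inv_lt_one₀ h0).1 hlt))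

theorem exists_uniformizer (v : Place F L) : ∃ π : L, v.val π = WithZero.exp (-1 : ℤ) :=
  (IsDiscreteValuationRing.maximalIdeal v.ring).valuation_exists_uniformizer L

/-- A chosen uniformizer at `v`. -/
def unif (v : Place F L) : L := v.exists_uniformizer.choose

@[simp] theorem val_unif (v : Place F L) : v.val v.unif = WithZero.exp (-1 : ℤ) :=
  v.exists_uniformizer.choose_spec

theorem val_unif_zpow (v : Place F L) (n : ℤ) : v.val (v.unif ^ n) = WithZero.exp (-n) := by
  rw [map_zpow₀, val_unif, ← WithZero.exp_zsmul]
  simp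

theorem unif_ne_zero (v : Place F L) : v.unif ≠ 0 := by
  intro h
  have := v.val_unif
  rw [h, map_zero] at this
  exact WithZero.exp_ne_zero this.symm

theorem val_ne_zero (v : Place F L) {x : L} (hx : x ≠ 0) : v.val x ≠ 0 :=
  (Valuation.ne_zero_iff _).2 hx

/-- The order as an integer, with value `0` at `0`. -/
def ordInt (v : Place F L) (x : L) : ℤ := -(WithZero.log (v.val x))

theorem ord_of_ne_zero (v : Place F L) {x : L} (hx : x ≠ 0) : v.ord x = (v.ordInt x : ℤ) := by
  rw [ord, if_neg hx, ordInt]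

theorem untopD_ord (v : Place F L) (x : L) : (v.ord x).untopD 0 = v.ordInt x := by
  by_cases hx : x = 0
  · simp [hx, ord, ordInt]
  · simp [v.ord_of_ne_zero hx]

theorem val_eq_exp (v : Place F L) {x : L} (hx : x ≠ 0) :
    v.val x = WithZero.exp (-v.ordInt x) := by
  rw [ordInt, neg_neg, WithZero.exp_log (v.val_ne_zero hx)]

theorem ordInt_mul (v : Place F L) {x y : L} (hx : x ≠ 0) (hy : y ≠ 0) :
    v.ordInt (x * y) = v.ordInt x + v.ordInt y := by
  rw [ordInt, map_mul, WithZero.log_mul (v.val_ne_zero hx) (v.val_ne_zero hy), ordInt, ordInt]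
  ring

@[simp] theorem ordInt_one (v : Place F L) : v.ordInt 1 = 0 := by simp [ordInt]

@[simp] theorem ordInt_zero (v : Place F L) : v.ordInt 0 = 0 := by simp [ordInt]

@[simp] theorem ordInt_neg (v : Place F L) (x : L) : v.ordInt (-x) = v.ordInt x := by
  simp [ordInt, Valuation.map_neg]

theorem ordInt_pow (v : Place F L) (x : L) (n : ℕ) :
    v.ordInt (x ^ n) = n * v.ordInt x := by
  rw [ordInt, map_pow, WithZero.log_pow, ordInt]
  simp

@[simp] theorem ordInt_inv (v : Place F L) (x : L) : v.ordInt x⁻¹ = -v.ordInt x := by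
  simp [ordInt]

theorem val_le_exp_iff (v : Place F L) {x : L} (hx : x ≠ 0) (n : ℤ) :
    v.val x ≤ WithZero.exp n ↔ -n ≤ v.ordInt x := by
  rw [v.val_eq_exp hx, WithZero.exp_le_exp]
  omega

theorem val_lt_one_iff (v : Place F L) {x : L} (hx : x ≠ 0) : v.val x < 1 ↔ 0 < v.ordInt x := by
  rw [v.val_eq_exp hx, ← WithZero.exp_zero, WithZero.exp_lt_exp]
  omega

theorem ordInt_pos_iff_mem (v : Place F L) {x : L} (hx : x ≠ 0) (hm : x ∈ v.ring) :
    0 < v.ordInt x ↔ (⟨x, hm⟩ : v.ring) ∈ IsLocalRing.maximalIdeal v.ring := by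
  rw [← v.val_lt_one_iff hx, ← v.val_coe_lt_one_iff]

/-- The real absolute value `2 ^ (-ord_v)`. -/
def abs (v : Place F L) : AbsoluteValue L ℝ :=
  (IsDiscreteValuationRing.maximalIdeal v.ring).adicAbv (K := L) (b := 2) one_lt_two

theorem abs_apply (v : Place F L) (x : L) : v.abs x =
    (WithZeroMulInt.toNNReal (e := 2) two_ne_zero (v.val x) : ℝ) := rfl

theorem abs_lt_abs_iff (v : Place F L) (x y : L) : v.abs x < v.abs y ↔ v.val x < v.val y := by
  rw [abs_apply, abs_apply, NNReal.coe_lt_coe]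
  exact (WithZeroMulInt.toNNReal_strictMono (e := 2) one_lt_two).lt_iff_lt

theorem abs_le_abs_iff (v : Place F L) (x y : L) : v.abs x ≤ v.abs y ↔ v.val x ≤ v.val y := by
  rw [← not_lt, abs_lt_abs_iff, not_lt]

theorem abs_isNontrivial (v : Place F L) : v.abs.IsNontrivial := by
  refine ⟨v.unif, v.unif_ne_zero, fun h => ?_⟩
  have : v.abs v.unif < v.abs 1 := by
    rw [abs_lt_abs_iff, val_unif, map_one, ← WithZero.exp_zero, WithZero.exp_lt_exp]
    norm_num
  rw [map_one, h] at this
  exact lt_irrefl _ this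

/-- Equivalent absolute values have the same closed unit ball, which is the valuation ring. -/
theorem eq_of_abs_isEquiv {v w : Place F L} (h : v.abs.IsEquiv w.abs) : v = w := by
  ext x
  have hv := v.abs_le_abs_iff x 1
  have hw := w.abs_le_abs_iff x 1
  rw [map_one v.val, val_le_one_iff] at hv
  rw [map_one w.val, val_le_one_iff] at hw
  rw [← hv, ← hw]
  exact h x 1

/-- Weak approximation at finitely many places. -/
theorem exists_val_sub_le {S : Set (Place F L)} (hS : S.Finite) (z : Place F L → L)
    (N : Place F L → ℤ) : ∃ x : L, ∀ v ∈ S, v.val (x - z v) ≤ WithZero.exp (N v) := by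
  have := hS.fintype
  have hd := AbsoluteValue.denseRange_algebraMap_pi (v := fun v : S => v.1.abs)
    (fun v => v.1.abs_isNontrivial)
    (fun v w hvw h => hvw (Subtype.ext (eq_of_abs_isEquiv h)))
  -- Density of the diagonal is applied to a product of balls; the radius at `v` is the absolute
  -- value of an element of valuation `exp (N v)`.
  have hopen : IsOpen (Set.pi Set.univ fun v : S =>
      Metric.ball ((WithAbs.equiv v.1.abs).symm (z v.1)) (v.1.abs (v.1.unif ^ (-N v.1)))) :=
    isOpen_set_pi Set.finite_univ fun v _ => Metric.isOpen_ball
  obtain ⟨x, hx⟩ := hd.exists_mem_open hopen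
    ⟨fun v : S => (WithAbs.equiv v.1.abs).symm (z v.1), fun v _ => Metric.mem_ball_self
      (v.1.abs.pos (zpow_ne_zero _ v.1.unif_ne_zero))⟩
  refine ⟨x, fun v hv => ?_⟩
  have h1 := hx ⟨v, hv⟩ (Set.mem_univ _)
  rw [Metric.mem_ball, dist_eq_norm] at h1
  have h2 : v.abs (x - z v) < v.abs (v.unif ^ (-N v)) := h1
  rw [abs_lt_abs_iff, val_unif_zpow, neg_neg] at h2
  exact h2.le

end Place

end Drinfeld

end

noncomputable section

namespace Drinfeld

open Polynomial IntermediateField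
open scoped IntermediateField.algebraAdjoinAdjoin

/-! ### Function fields of one variable -/

/-- `L` is a function field of one variable over `F`: it contains a transcendental element, and is
finite over the subfield generated by any of these. -/
class IsFunctionField (F L : Type*) [Field F] [Field L] [Algebra F L] : Prop where
  exists_transcendental : ∃ y : L, Transcendental F y
  finite_adjoin : ∀ y : L, Transcendental F y → FiniteDimensional F⟮y⟯ L

theorem trdeg_ratFunc (F : Type*) [Field F] : Algebra.trdeg F (RatFunc F) = 1 := by
  have h := lift_trdeg_add_eq F F[X] (RatFunc F)
  have : Algebra.trdeg F[X] (RatFunc F) = 0 :=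
    trdeg_eq_zero_iff.2 (IsFractionRing.comap_isAlgebraic_iff (K := RatFunc F)
      (A := F[X]) (C := RatFunc F) |>.2 inferInstance)
  rw [this, Polynomial.trdeg_of_isDomain] at h
  simpa using h.symm

/-- The transcendence degree is `1`, so a transcendental `y` is already a transcendence basis. Then
`L` is algebraic and essentially of finite type over `F(y)`, hence finite. -/
theorem isFunctionField_of_ratFunc {F L : Type*} [Field F] [Field L] [Algebra F L]
    [Algebra (RatFunc F) L] [IsScalarTower F (RatFunc F) L] [FiniteDimensional (RatFunc F) L] :
    IsFunctionField F L where
  exists_transcendental := by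
    refine ⟨algebraMap (RatFunc F) L RatFunc.X, ?_⟩
    rw [transcendental_algebraMap_iff (algebraMap (RatFunc F) L).injective]
    rw [← RatFunc.algebraMap_X,
      transcendental_algebraMap_iff (RatFunc.algebraMap_injective F)]
    exact Polynomial.transcendental_X F
  finite_adjoin := by
    intro y hy
    have h := lift_trdeg_add_eq F (RatFunc F) L
    have h0 : Algebra.trdeg (RatFunc F) L = 0 := trdeg_eq_zero_iff.2 inferInstance
    rw [h0, trdeg_ratFunc] at h
    have hb : IsTranscendenceBasis F (fun _ : Unit => y) := by
      refine AlgebraicIndependent.isTranscendenceBasis_of_lift_trdeg_le_of_finite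
        (algebraicIndependent_unique_type_iff.2 hy) ?_
      have h1 : Algebra.trdeg F L = 1 := by simpa using h.symm
      simp [h1]
    have ha : Algebra.IsAlgebraic F⟮y⟯ L := by
      have := hb.isAlgebraic_field
      rwa [Set.range_const] at this
    have : Algebra.EssFiniteType F (RatFunc F) :=
      have := Algebra.EssFiniteType.of_isLocalization (R := F[X]) (RatFunc F) (nonZeroDivisors F[X])
      Algebra.EssFiniteType.comp F F[X] (RatFunc F)
    have : Algebra.EssFiniteType F L := Algebra.EssFiniteType.comp F (RatFunc F) L
    have : Algebra.EssFiniteType F⟮y⟯ L := Algebra.EssFiniteType.of_comp F F⟮y⟯ L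
    exact Algebra.finite_of_essFiniteType_of_isAlgebraic

variable {F L : Type*} [Field F] [Field L] [Algebra F L]

theorem ne_zero_of_transcendental {y : L} (hy : Transcendental F y) : y ≠ 0 := by
  rintro rfl
  exact hy isAlgebraic_zero

theorem transcendental_inv {y : L} (hy : Transcendental F y) : Transcendental F y⁻¹ := by
  intro h
  exact hy (by simpa using h.inv)

/-- Independence over `F[y]` follows from independence over `F` modulo `y`. -/
theorem eq_zero_of_sum_aeval_eq_zero {y : L} (hy : y ≠ 0) (A : Submodule F L)
    (hA : ∀ a ∈ A, y * a ∈ A) {ι : Type*} [Fintype ι] (z : ι → L) (hz : ∀ i, z i ∈ A)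
    (h : ∀ c : ι → F, (∃ a ∈ A, ∑ i, c i • z i = y * a) → c = 0) (p : ι → F[X])
    (hp : ∑ i, aeval y (p i) * z i = 0) : p = 0 := by
  have hpow : ∀ (g : F[X]), ∀ a ∈ A, aeval y g * a ∈ A := by
    intro g
    induction g using Polynomial.induction_on' with
    | add f g hf hg => intro a ha; rw [map_add, add_mul]; exact A.add_mem (hf a ha) (hg a ha)
    | monomial n c =>
      intro a ha
      rw [aeval_monomial, mul_assoc, ← Algebra.smul_def]
      refine A.smul_mem c ?_
      induction n with
      | zero => simpa using ha
      | succ n ih => rw [pow_succ', mul_assoc]; exact hA _ ih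
  suffices H : ∀ (N : ℕ) (p : ι → F[X]), (∀ i, (p i).degree < N) →
      ∑ i, aeval y (p i) * z i = 0 → p = 0 by
    refine H (Finset.univ.sup (fun i => (p i).natDegree) + 1) p (fun i => ?_) hp
    refine lt_of_le_of_lt degree_le_natDegree ?_
    have := Finset.le_sup (f := fun i => (p i).natDegree) (Finset.mem_univ i)
    exact_mod_cast Nat.lt_succ_of_le this
  intro N
  induction N with
  | zero =>
    intro p hp _
    funext i
    have := hp i
    simpa [Nat.WithBot.lt_zero_iff] using this
  | succ N ih =>
    intro p hp hs
    have hdec : ∀ i, aeval y (p i) * z i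
        = y * (aeval y (p i).divX * z i) + (p i).coeff 0 • z i := by
      intro i
      conv_lhs => rw [← X_mul_divX_add (p i)]
      rw [map_add, map_mul, aeval_X, aeval_C, Algebra.smul_def]
      ring
    have hsum : ∑ i, aeval y (p i) * z i
        = y * (∑ i, aeval y (p i).divX * z i) + ∑ i, (p i).coeff 0 • z i := by
      rw [Finset.sum_congr rfl fun i _ => hdec i, Finset.sum_add_distrib, Finset.mul_sum]
    -- The constant terms give a combination lying in `yA`, so they vanish; after division by `y`
    -- the degree bound drops.
    have hc : (fun i => (p i).coeff 0) = 0 := by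
      refine h _ ⟨-∑ i, aeval y (p i).divX * z i, A.neg_mem
        (A.sum_mem fun i _ => hpow _ _ (hz i)), ?_⟩
      rw [hs] at hsum
      linear_combination -hsum
    have hd : (fun i => (p i).divX) = 0 := by
      refine ih _ (fun i => ?_) ?_
      · by_cases h0 : (p i).divX = 0
        · rw [h0, degree_zero]; exact WithBot.bot_lt_coe _
        · have hne : p i ≠ 0 := fun h1 => h0 (by rw [h1, divX_zero])
          have h2 := hp i
          rw [degree_eq_natDegree hne] at h2
          rw [degree_eq_natDegree h0, natDegree_divX_eq_natDegree_tsub_one]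
          have h3 : (p i).natDegree ≠ 0 := by
            intro h4
            rw [eq_C_of_natDegree_eq_zero h4, divX_C] at h0
            exact h0 rfl
          have h5 : (p i).natDegree < N + 1 := by exact_mod_cast h2
          exact_mod_cast (by omega : (p i).natDegree - 1 < N)
      · rw [hs, show ∑ i, (p i).coeff 0 • z i = 0 from
          Finset.sum_eq_zero fun i _ => by rw [show (p i).coeff 0 = 0 from congrFun hc i, zero_smul],
          add_zero] at hsum
        exact (mul_eq_zero.1 hsum.symm).resolve_left hy
    funext i
    rw [← X_mul_divX_add (p i), show (p i).divX = 0 from congrFun hd i,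
      show (p i).coeff 0 = 0 from congrFun hc i]
    simp

/-- Denominators can be cleared, since `F(y)` is the fraction field of `F[y]`, and transcendence of
`y` identifies `F[y]` with polynomials. -/
theorem linearIndependent_adjoin_iff {y : L} (hy : Transcendental F y) {ι : Type*} [Fintype ι]
    (z : ι → L) : LinearIndependent F⟮y⟯ z ↔
      ∀ p : ι → F[X], ∑ i, aeval y (p i) * z i = 0 → p = 0 := by
  rw [← LinearIndependent.iff_fractionRing (Algebra.adjoin F {y}) F⟮y⟯, Fintype.linearIndependent_iff]
  constructor
  · intro h p hp
    have := h (fun i => ⟨aeval y (p i), aeval_mem_adjoin_singleton F y⟩) hp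
    funext i
    have h1 : aeval y (p i) = 0 := congrArg Subtype.val (this i)
    by_contra h2
    exact h2 (transcendental_iff.1 hy (p i) h1)
  · intro h g hg i
    have hx : ∀ i, ∃ p : F[X], aeval y p = (g i : L) := by
      intro i
      have := (Algebra.adjoin_singleton_eq_range_aeval F y).le (g i).2
      exact this
    choose p hp using hx
    have h0 := h p (by
      rw [← hg]
      exact Finset.sum_congr rfl fun i _ => by rw [hp]; rfl)
    apply Subtype.ext
    rw [← hp i, h0]
    simp

theorem card_le_finrank_adjoin {y : L} (hy : Transcendental F y) [FiniteDimensional F⟮y⟯ L]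
    (A : Submodule F L) (hA : ∀ a ∈ A, y * a ∈ A) {ι : Type*} [Fintype ι] (z : ι → L)
    (hz : ∀ i, z i ∈ A)
    (h : ∀ c : ι → F, (∃ a ∈ A, ∑ i, c i • z i = y * a) → c = 0) :
    Fintype.card ι ≤ Module.finrank F⟮y⟯ L :=
  ((linearIndependent_adjoin_iff hy z).2 (eq_zero_of_sum_aeval_eq_zero (ne_zero_of_transcendental hy) A hA z hz h)
    ).fintype_card_le_finrank

/-- A quotient of an `F[y]`-submodule of `L` that is killed by `y` has dimension at most
`[L : F(y)]` over `F`. -/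
theorem finite_and_finrank_le_of_surjective {y : L} (hy : Transcendental F y)
    [FiniteDimensional F⟮y⟯ L]
    (A : Submodule F L) (hA : ∀ a ∈ A, y * a ∈ A) {M : Type*} [AddCommGroup M] [Module F M]
    (f : A →ₗ[F] M) (hf : Function.Surjective f)
    (hfy : ∀ a : A, f ⟨y * a, hA a a.2⟩ = 0) :
    Module.Finite F M ∧ Module.finrank F M ≤ Module.finrank F⟮y⟯ L := by
  have hr : Module.rank F M ≤ (Module.finrank F⟮y⟯ L : ℕ) := by
    refine rank_le fun s hs => ?_
    choose g hg using hf
    -- Lifts of independent vectors of `M` are independent modulo `yA`, because `f` kills `yA`.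
    have := card_le_finrank_adjoin hy A hA (fun i : s => (g i : L)) (fun i => (g i).2) (by
      rintro c ⟨a, ha, he⟩
      have he' : ∑ i, c i • g (i : M) = ⟨y * a, hA a ha⟩ := by
        apply Subtype.ext
        simpa using he
      have h1 := congrArg f he'
      rw [hfy ⟨a, ha⟩, map_sum] at h1
      simp only [map_smul, hg] at h1
      funext i
      exact Fintype.linearIndependent_iff.1 hs c h1 i)
    simpa using this
  have hfin : Module.Finite F M :=
    Module.rank_lt_aleph0_iff.1 (lt_of_le_of_lt hr (Cardinal.natCast_lt_aleph0))
  refine ⟨hfin, ?_⟩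
  rw [← Module.finrank_eq_rank] at hr
  exact_mod_cast hr

end Drinfeld

end

noncomputable section

namespace Drinfeld

open Polynomial IntermediateField

variable {F L : Type*} [Field F] [Field L] [Algebra F L]

/-! ### Existence of places -/

/-- A valuation ring that contains `F` contains the inverses of its algebraic elements. -/
theorem inv_mem_of_isAlgebraic {O : ValuationSubring L} (hO : ∀ c : F, algebraMap F L c ∈ O)
    {x : L} (hx : x ∈ O) (ha : IsAlgebraic F x) : x⁻¹ ∈ O := by
  have h := ha.isIntegral.inv_mem_adjoin
  let O' : Subalgebra F L := { O.toSubring with algebraMap_mem' := hO }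
  have hle : Algebra.adjoin F {x} ≤ O' := Algebra.adjoin_le (Set.singleton_subset_iff.2 hx)
  exact hle h

theorem transcendental_of_not_isUnit {O : ValuationSubring L}
    (hO : ∀ c : F, algebraMap F L c ∈ O) {x : O} (hx0 : x ≠ 0) (hx : ¬ IsUnit x) :
    Transcendental F (x : L) := by
  intro ha
  refine hx (IsUnit.of_mul_eq_one ⟨(x : L)⁻¹, inv_mem_of_isAlgebraic hO x.2 ha⟩ ?_)
  apply Subtype.ext
  exact mul_inv_cancel₀ (fun h => hx0 (Subtype.ext h))

theorem valuation_algebraMap_eq_one {O : ValuationSubring L}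
    (hO : ∀ c : F, algebraMap F L c ∈ O) {c : F} (hc : c ≠ 0) :
    O.valuation (algebraMap F L c) = 1 := by
  refine (O.valuation_eq_one_iff ⟨_, hO c⟩).1 (IsUnit.of_mul_eq_one ⟨_, hO c⁻¹⟩ ?_)
  apply Subtype.ext
  change algebraMap F L c * algebraMap F L c⁻¹ = 1
  rw [← map_mul, mul_inv_cancel₀ hc, map_one]

/-- Valuation rings of a function field are discrete. -/
theorem wfDvdMonoid_of_isFunctionField [IsFunctionField F L] {O : ValuationSubring L}
    (hO : ∀ c : F, algebraMap F L c ∈ O) : WfDvdMonoid O := by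
  classical
  refine ⟨wellFounded_iff_isEmpty_descending_chain.2 ⟨fun ⟨f, hstep⟩ => ?_⟩⟩
  have hne : ∀ n, f (n + 1) ≠ 0 := fun n => (hstep n).1
  have hnu : ∀ n, ¬ IsUnit (f n) := by
    intro n hu
    obtain ⟨-, x, hx, he⟩ := hstep n
    rw [he] at hu
    exact hx (isUnit_of_mul_isUnit_right hu)
  -- Along an infinite chain of proper divisors the valuations increase strictly.
  have hlt : ∀ n, O.valuation (f (n + 1)) < O.valuation (f (n + 2)) := by
    intro n
    obtain ⟨h0, x, hx, he⟩ := hstep (n + 1)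
    have hvx : O.valuation (x : L) < 1 :=
      (O.valuation_lt_one_or_eq_one x).resolve_right fun h => hx ((O.valuation_eq_one_iff x).2 h)
    have h1 : (f (n + 1) : L) = (f (n + 2) : L) * (x : L) := congrArg Subtype.val he
    have h2 : O.valuation (f (n + 2) : L) ≠ 0 :=
      (Valuation.ne_zero_iff _).2 fun h => h0 (Subtype.ext h)
    rw [h1, map_mul]
    exact mul_lt_of_lt_one_right (zero_lt_iff.2 h2) hvx
  have hmono : StrictMono fun n => O.valuation (f (n + 1) : L) := strictMono_nat_of_lt_succ hlt
  have hy : Transcendental F (f 1 : L) := transcendental_of_not_isUnit hO (hne 0) (hnu 1)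
  have := IsFunctionField.finite_adjoin _ hy
  let A : Submodule F L :=
    { carrier := {x | O.valuation x < 1}
      zero_mem' := by simp
      add_mem' := fun {x y} hx hy => lt_of_le_of_lt (O.valuation.map_add x y) (max_lt hx hy)
      smul_mem' := fun c x hx => by
        change O.valuation (c • x) < 1
        rw [Algebra.smul_def, map_mul]
        exact lt_of_le_of_lt (mul_le_of_le_one_left' (O.valuation_le_one ⟨_, hO c⟩)) hx }
  have hlt1 : ∀ n, O.valuation (f n : L) < 1 := fun n =>
    (O.valuation_lt_one_or_eq_one (f n)).resolve_right
      fun h => hnu n ((O.valuation_eq_one_iff (f n)).2 h)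
  -- With `y = f 1` and `A` the maximal ideal, any number of terms `f 1, f 2, …` is independent
  -- modulo `yA`. Their values are distinct, so a nontrivial combination has value at least that of
  -- `f 1`, while elements of `yA` have strictly smaller value. One term more than `[L : F(y)]` is a
  -- contradiction.
  have hcard := card_le_finrank_adjoin hy A
    (fun a ha => by
      change O.valuation _ < 1
      rw [map_mul]
      exact lt_of_le_of_lt (mul_le_of_le_one_left' (hlt1 1).le) ha)
    (fun i : Fin (Module.finrank F⟮(f 1 : L)⟯ L + 1) => (f (i + 1) : L))
    (fun i => hlt1 _) (by
      rintro c ⟨a, ha, he⟩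
      by_contra hc
      obtain ⟨i₀, hi₀⟩ : ∃ i, c i ≠ 0 := by
        by_contra h
        push Not at h
        exact hc (funext h)
      obtain ⟨j, hj, hmax⟩ := (Finset.univ.filter fun i => c i ≠ 0).exists_max_image id
        ⟨i₀, by simpa using hi₀⟩
      have hj' : c j ≠ 0 := by simpa using hj
      have hval : ∀ i, c i ≠ 0 → O.valuation (c i • (f (i + 1) : L)) =
          O.valuation (f (i + 1) : L) := fun i hi => by
        rw [Algebra.smul_def, map_mul, valuation_algebraMap_eq_one hO hi, one_mul]
      have hsum : O.valuation (∑ i, c i • (f (i + 1) : L)) = O.valuation (c j • (f (j + 1) : L)) := by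
        refine Valuation.map_sum_eq_of_lt _ (Finset.mem_univ j) fun i hi => ?_
        have hij : i ≠ j := by simpa using hi
        rw [hval j hj']
        by_cases hi0 : c i = 0
        · rw [hi0, zero_smul, map_zero, zero_lt_iff]
          exact (Valuation.ne_zero_iff _).2 fun h => hne j (Subtype.ext h)
        · rw [hval i hi0]
          have : i ≤ j := hmax i (by simpa using hi0)
          exact hmono (Fin.val_strictMono (lt_of_le_of_ne this hij))
      rw [he, hval j hj', map_mul] at hsum
      have h1 : O.valuation (f 1 : L) ≤ O.valuation (f (j + 1) : L) :=
        hmono.monotone (Nat.zero_le j)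
      rw [← hsum] at h1
      have h0 : O.valuation (f 1 : L) ≠ 0 :=
        (Valuation.ne_zero_iff _).2 fun h => hne 0 (Subtype.ext h)
      exact absurd h1 (not_le.2 (mul_lt_of_lt_one_right (zero_lt_iff.2 h0) ha)))
  simp at hcard

/-- Every transcendental element of a function field has a zero. -/
theorem exists_place_ordInt_pos [IsFunctionField F L] {y : L} (hy : Transcendental F y) :
    ∃ v : Place F L, 0 < v.ordInt y := by
  let R := (Algebra.adjoin F {y}).toSubring
  let y' : R := ⟨y, Algebra.self_mem_adjoin_singleton F y⟩
  -- As `y` is not invertible in `F[y]`, some valuation ring containing `F[y]` has `y` among its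
  -- non-units.
  have hI : Ideal.span {y'} ≠ ⊤ := by
    intro h
    rw [Ideal.span_singleton_eq_top] at h
    obtain ⟨b, hb⟩ := h.exists_right_inv
    obtain ⟨p, hp⟩ := (Algebra.adjoin_singleton_eq_range_aeval F y).le b.2
    have hb' : y * (b : L) = 1 := congrArg Subtype.val hb
    have h1 : aeval y (X * p - 1) = 0 := by
      rw [map_sub, map_mul, aeval_X, map_one]
      change y * (aeval y).toRingHom p - 1 = 0
      rw [sub_eq_zero, ← hb']
      exact congrArg (y * ·) hp
    have h2 := transcendental_iff.1 hy _ h1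
    have h3 := congrArg (fun q => coeff q 0) h2
    simp at h3
  obtain ⟨B, hB, hIB⟩ := Ideal.image_subset_nonunits_valuationSubring _ hI
  have hF : ∀ c : F, algebraMap F L c ∈ B := fun c =>
    hB (show algebraMap F L c ∈ R from (Algebra.adjoin F {y}).algebraMap_mem c)
  have hyB : y ∈ B.nonunits := hIB ⟨y', Ideal.mem_span_singleton_self y', rfl⟩
  have hyB' : y ∈ B := B.nonunits_subset hyB
  have hym : (⟨y, hyB'⟩ : B) ∈ IsLocalRing.maximalIdeal B := B.coe_mem_nonunits_iff.1 hyB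
  have hwf := wfDvdMonoid_of_isFunctionField hF
  -- A valuation ring is Bézout, so well-foundedness of divisibility makes it principal; the nonzero
  -- non-unit `y` shows that it is not a field.
  have hpid : IsPrincipalIdealRing B := ((IsBezout.TFAE (R := B)).out 3 1).1 hwf
  have hdvr : IsDiscreteValuationRing B :=
    { not_a_field' := fun h => by
        rw [h, Ideal.mem_bot] at hym
        exact ne_zero_of_transcendental hy (congrArg Subtype.val hym) }
  let v : Place F L := ⟨B, hF, hdvr⟩
  exact ⟨v, (v.ordInt_pos_iff_mem (ne_zero_of_transcendental hy) hyB').2 hym⟩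

namespace Place

/-- Valuation rings over `F` contain every algebraic element: it or its inverse lies there, and then
both do. -/
theorem ordInt_eq_zero_of_isAlgebraic (v : Place F L) {x : L} (ha : IsAlgebraic F x) :
    v.ordInt x = 0 := by
  by_cases h0 : x = 0
  · simp [h0]
  have key : ∀ z : L, z ≠ 0 → IsAlgebraic F z → 0 ≤ v.ordInt z := by
    intro z hz hza
    rcases v.ring.mem_or_inv_mem z with h | h
    · have := (v.val_le_one_iff z).2 h
      rw [← WithZero.exp_zero, v.val_le_exp_iff hz] at this
      simpa using this
    · have h1 := inv_mem_of_isAlgebraic v.algebraMap_mem h hza.inv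
      rw [inv_inv] at h1
      have := (v.val_le_one_iff z).2 h1
      rw [← WithZero.exp_zero, v.val_le_exp_iff hz] at this
      simpa using this
  have h1 := key x h0 ha
  have h2 := key x⁻¹ (inv_ne_zero h0) ha.inv
  rw [ordInt_inv] at h2
  omega

theorem transcendental_of_ordInt_ne_zero (v : Place F L) {x : L} (h : v.ordInt x ≠ 0) :
    Transcendental F x := fun ha => h (v.ordInt_eq_zero_of_isAlgebraic ha)

@[simp] theorem ordInt_unif (v : Place F L) : v.ordInt v.unif = 1 := by
  simp [ordInt]

theorem transcendental_unif (v : Place F L) : Transcendental F v.unif :=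
  v.transcendental_of_ordInt_ne_zero (by simp)

/-- The residue field is a quotient of the valuation ring killed by a uniformizer `π`, so its
dimension is at most `[L : F(π)]`. -/
theorem finite_residueField [IsFunctionField F L] (v : Place F L) :
    Module.Finite F (IsLocalRing.ResidueField v.ring) := by
  have := IsFunctionField.finite_adjoin _ v.transcendental_unif
  let A : Submodule F L :=
    { carrier := v.ring
      zero_mem' := v.ring.zero_mem
      add_mem' := fun {x y} hx hy => v.ring.add_mem x y hx hy
      smul_mem' := fun c x hx => by
        rw [Algebra.smul_def]
        exact v.ring.mul_mem _ _ (v.algebraMap_mem c) hx }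
  have hu : v.unif ∈ v.ring := by
    rw [← val_le_one_iff, val_unif, ← WithZero.exp_zero, WithZero.exp_le_exp]; norm_num
  have hA : ∀ a ∈ A, v.unif * a ∈ A := fun a ha => v.ring.mul_mem _ _ hu ha
  let f : A →ₗ[F] IsLocalRing.ResidueField v.ring :=
    { toFun := fun a => IsLocalRing.residue v.ring ⟨a, a.2⟩
      map_add' := fun a b => by rw [← map_add]; rfl
      map_smul' := fun c a => by
        rw [RingHom.id_apply, Algebra.smul_def]
        change _ = IsLocalRing.residue v.ring (algebraMap F v.ring c) * _
        rw [← map_mul]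
        congr 1
        apply Subtype.ext
        exact Algebra.smul_def c (a : L) }
  refine (finite_and_finrank_le_of_surjective v.transcendental_unif A hA f ?_ ?_).1
  · intro x
    obtain ⟨a, rfl⟩ := IsLocalRing.residue_surjective x
    exact ⟨⟨a, a.2⟩, rfl⟩
  · intro a
    change IsLocalRing.residue v.ring _ = 0
    rw [IsLocalRing.residue_eq_zero_iff, ← val_coe_lt_one_iff]
    change v.val (v.unif * a) < 1
    rw [map_mul, val_unif]
    refine lt_of_le_of_lt (mul_le_of_le_one_right' (v.val_coe_le_one ⟨a, a.2⟩)) ?_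
    rw [← WithZero.exp_zero, WithZero.exp_lt_exp]; norm_num

theorem degree_pos [IsFunctionField F L] (v : Place F L) : 0 < v.degree :=
  have := v.finite_residueField
  Module.finrank_pos

theorem natCard_residueField [Fintype F] [IsFunctionField F L] (v : Place F L) :
    Nat.card (IsLocalRing.ResidueField v.ring) = Fintype.card F ^ v.degree := by
  have := v.finite_residueField
  rw [Module.natCard_eq_pow_finrank (K := F), Nat.card_eq_fintype_card, degree]

end Place

end Drinfeld

end

noncomputable section

namespace Drinfeld

open Polynomial IntermediateField

variable {F L : Type*} [Field F] [Field L] [Algebra F L]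

/-! ### Spaces of functions with bounded poles on a set of places -/

/-- The elements of `L` whose poles on the set `S` of places are bounded by `D`. -/
def boundedOn (S : Set (Place F L)) (D : FormalDivisor F L) : Submodule F L where
  carrier := {x | ∀ v ∈ S, v.val x ≤ WithZero.exp (D v)}
  zero_mem' := fun v _ => by simp
  add_mem' := fun {x y} hx hy v hv => Valuation.map_add_le _ (hx v hv) (hy v hv)
  smul_mem' := fun c x hx v hv => by
    rw [Algebra.smul_def, map_mul]
    exact le_trans (mul_le_of_le_one_left' (v.val_algebraMap_le c)) (hx v hv)

theorem mem_boundedOn {S : Set (Place F L)} {D : FormalDivisor F L} {x : L} :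
    x ∈ boundedOn S D ↔ ∀ v ∈ S, v.val x ≤ WithZero.exp (D v) := Iff.rfl

theorem boundedOn_univ (D : FormalDivisor F L) :
    boundedOn Set.univ D = riemannRochSpace D := by
  ext x
  rw [mem_boundedOn]
  change _ ↔ ∀ v : Place F L, ((-(D v) : ℤ) : WithTop ℤ) ≤ v.ord x
  simp only [Place.le_ord_iff, neg_neg, Set.mem_univ, true_implies]

theorem boundedOn_mono (S : Set (Place F L)) {D D' : FormalDivisor F L} (h : D ≤ D') :
    boundedOn S D ≤ boundedOn S D' :=
  fun _ hx v hv => (hx v hv).trans (WithZero.exp_le_exp.2 (h v))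

open Classical in
/-- The leading coefficient at `v` of the elements of `boundedOn S (D + v)`. -/
def leadingCoeff (S : Set (Place F L)) (D : FormalDivisor F L) {v : Place F L} (hv : v ∈ S) :
    (boundedOn S (D + Pi.single v 1)).toAddSubgroup →+ IsLocalRing.ResidueField v.ring where
  toFun x := IsLocalRing.residue v.ring ⟨x * v.unif ^ (D v + 1), by
    rw [← Place.val_le_one_iff, map_mul, Place.val_unif_zpow]
    refine (mul_le_mul_left (x.2 v hv) _).trans ?_
    rw [← WithZero.exp_add]
    simp⟩
  map_zero' := by
    rw [IsLocalRing.residue_eq_zero_iff]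
    convert Ideal.zero_mem _
    simp
  map_add' x y := by
    rw [← map_add]
    congr 1
    apply Subtype.ext
    exact add_mul _ _ _

open Classical in
theorem ker_leadingCoeff (S : Set (Place F L)) (D : FormalDivisor F L) {v : Place F L}
    (hv : v ∈ S) : (leadingCoeff S D hv).ker =
      (boundedOn S D).toAddSubgroup.addSubgroupOf
        (boundedOn S (D + Pi.single v 1)).toAddSubgroup := by
  ext x
  rw [AddMonoidHom.mem_ker, AddSubgroup.mem_addSubgroupOf]
  change IsLocalRing.residue v.ring _ = 0 ↔ (x : L) ∈ boundedOn S D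
  rw [IsLocalRing.residue_eq_zero_iff, ← Place.val_coe_lt_one_iff]
  change v.val ((x : L) * v.unif ^ (D v + 1)) < 1 ↔ _
  have hiff : v.val ((x : L) * v.unif ^ (D v + 1)) < 1 ↔ v.val (x : L) ≤ WithZero.exp (D v) := by
    by_cases h0 : (x : L) = 0
    · simp [h0]
    · rw [map_mul, Place.val_unif_zpow, v.val_eq_exp h0, ← WithZero.exp_add, ← WithZero.exp_zero,
        WithZero.exp_lt_exp, WithZero.exp_le_exp]
      omega
  rw [hiff, mem_boundedOn]
  refine ⟨fun h w hw => ?_, fun h => h v hv⟩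
  by_cases hwv : w = v
  · subst hwv; exact h
  · have := x.2 w hw
    simpa [Pi.single_eq_of_ne hwv] using this

open Classical in
-- The leading coefficient embeds the quotient into the residue field, and weak approximation makes
-- it onto when `S` is finite. A `relIndex` of `0` would mean infinite index, hence the first
-- clause.
theorem relIndex_boundedOn_single [Fintype F] [IsFunctionField F L] (S : Set (Place F L))
    (D : FormalDivisor F L) {v : Place F L} (hv : v ∈ S) :
    (boundedOn S D).toAddSubgroup.relIndex (boundedOn S (D + Pi.single v 1)).toAddSubgroup ≠ 0 ∧
    (boundedOn S D).toAddSubgroup.relIndex (boundedOn S (D + Pi.single v 1)).toAddSubgroup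
      ≤ Fintype.card F ^ v.degree ∧
    (S.Finite →
      (boundedOn S D).toAddSubgroup.relIndex (boundedOn S (D + Pi.single v 1)).toAddSubgroup
      = Fintype.card F ^ v.degree) := by
  have hκ : Finite (IsLocalRing.ResidueField v.ring) :=
    have := v.finite_residueField
    Module.finite_of_finite F
  rw [AddSubgroup.relIndex, ← ker_leadingCoeff S D hv, AddSubgroup.index_ker,
    ← v.natCard_residueField]
  refine ⟨Nat.card_pos.ne', Nat.card_le_card_of_injective _ Subtype.val_injective, fun hS => ?_⟩
  have hsurj : Function.Surjective (leadingCoeff S D hv) := by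
    intro r
    obtain ⟨a, rfl⟩ := IsLocalRing.residue_surjective r
    -- The target is a function with the prescribed leading coefficient at `v` and `0` elsewhere;
    -- errors bounded by `D` change nothing.
    obtain ⟨x, hx⟩ := Place.exists_val_sub_le hS
      (Pi.single v ((a : L) * v.unif ^ (-(D v + 1)))) D
    have hb : v.val ((a : L) * v.unif ^ (-(D v + 1))) ≤ WithZero.exp (D v + 1) := by
      rw [map_mul, Place.val_unif_zpow, neg_neg]
      exact mul_le_of_le_one_left' (v.val_coe_le_one a)
    have hxm : x ∈ boundedOn S (D + Pi.single v 1) := by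
      intro w hw
      have h1 := hx w hw
      by_cases hwv : w = v
      · subst hwv
        rw [Pi.single_eq_same] at h1
        have h2 := Valuation.map_add_le _ (h1.trans (WithZero.exp_le_exp.2
          (show D w ≤ D w + 1 by omega))) hb
        simpa using h2
      · simpa [Pi.single_eq_of_ne hwv] using h1
    refine ⟨⟨x, hxm⟩, ?_⟩
    change IsLocalRing.residue v.ring _ = _
    rw [← sub_eq_zero, ← map_sub, IsLocalRing.residue_eq_zero_iff, ← Place.val_coe_lt_one_iff]
    change v.val (x * v.unif ^ (D v + 1) - (a : L)) < 1
    have h1 := hx v hv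
    rw [Pi.single_eq_same] at h1
    have h3 : x * v.unif ^ (D v + 1) - (a : L)
        = (x - (a : L) * v.unif ^ (-(D v + 1))) * v.unif ^ (D v + 1) := by
      rw [sub_mul, mul_assoc, ← zpow_add₀ v.unif_ne_zero]
      simp
    rw [h3, map_mul, Place.val_unif_zpow]
    refine lt_of_le_of_lt (mul_le_mul_left h1 _) ?_
    rw [← WithZero.exp_add, ← WithZero.exp_zero, WithZero.exp_lt_exp]
    omega
  rw [AddMonoidHom.range_eq_top_of_surjective _ hsurj]
  exact Nat.card_congr AddSubgroup.topEquiv.toEquiv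

/-- The degree of an effective divisor, given as a multiset of places. -/
def degM (m : Multiset (Place F L)) : ℕ := (m.map Place.degree).sum

open Classical in
/-- The formal divisor of a multiset of places. -/
def divM (m : Multiset (Place F L)) : FormalDivisor F L := fun v => m.count v

@[simp] theorem degM_zero : degM (0 : Multiset (Place F L)) = 0 := rfl

@[simp] theorem degM_cons (v : Place F L) (m : Multiset (Place F L)) :
    degM (v ::ₘ m) = v.degree + degM m := by simp [degM]

@[simp] theorem degM_add (m m' : Multiset (Place F L)) : degM (m + m') = degM m + degM m' := by
  simp [degM]

@[simp] theorem degM_nsmul (n : ℕ) (m : Multiset (Place F L)) : degM (n • m) = n * degM m := by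
  simp [degM, Multiset.map_nsmul, Multiset.sum_nsmul]

@[simp] theorem divM_zero : divM (0 : Multiset (Place F L)) = 0 := by
  funext v; simp [divM]

@[simp] theorem divM_add (m m' : Multiset (Place F L)) : divM (m + m') = divM m + divM m' := by
  funext v; simp [divM]

open Classical in
theorem divM_cons (v : Place F L) (m : Multiset (Place F L)) :
    divM (v ::ₘ m) = divM m + Pi.single v 1 := by
  funext w
  by_cases h : w = v
  · subst h; simp [divM]
  · simp [divM, h]

theorem divM_nonneg (m : Multiset (Place F L)) : 0 ≤ divM m := fun v => by simp [divM]

theorem relIndex_boundedOn [Fintype F] [IsFunctionField F L] (S : Set (Place F L))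
    (D : FormalDivisor F L) (m : Multiset (Place F L)) (hm : ∀ v ∈ m, v ∈ S) :
    (boundedOn S D).toAddSubgroup.relIndex (boundedOn S (D + divM m)).toAddSubgroup ≠ 0 ∧
    (boundedOn S D).toAddSubgroup.relIndex (boundedOn S (D + divM m)).toAddSubgroup
      ≤ Fintype.card F ^ degM m ∧
    (S.Finite → (boundedOn S D).toAddSubgroup.relIndex (boundedOn S (D + divM m)).toAddSubgroup
      = Fintype.card F ^ degM m) := by
  classical
  induction m using Multiset.induction with
  | empty => simp
  | cons v m ih =>
    obtain ⟨h1, h2, h3⟩ := ih fun w hw => hm w (Multiset.mem_cons_of_mem hw)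
    obtain ⟨k1, k2, k3⟩ := relIndex_boundedOn_single S (D + divM m)
      (hm v (Multiset.mem_cons_self v m))
    have hle1 : (boundedOn S D).toAddSubgroup ≤ (boundedOn S (D + divM m)).toAddSubgroup :=
      boundedOn_mono S (le_add_of_nonneg_right (divM_nonneg m))
    have hle2 : (boundedOn S (D + divM m)).toAddSubgroup
        ≤ (boundedOn S (D + divM m + Pi.single v 1)).toAddSubgroup :=
      boundedOn_mono S (le_add_of_nonneg_right (Pi.single_nonneg.2 zero_le_one))
    rw [divM_cons, ← add_assoc, ← AddSubgroup.relIndex_mul_relIndex _ _ _ hle1 hle2, degM_cons,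
      pow_add, mul_comm (Fintype.card F ^ v.degree)]
    exact ⟨mul_ne_zero h1 k1, Nat.mul_le_mul h2 k2, fun hS => by rw [h3 hS, k3 hS]⟩

end Drinfeld

end

noncomputable section

namespace Drinfeld

open Polynomial IntermediateField

/-! ### The product formula and finiteness of Riemann–Roch spaces -/

section

variable {F L : Type*} [Field F] [Field L] [Algebra F L]

open Classical in
theorem count_sum_nsmul (T : Finset (Place F L)) (e : Place F L → ℕ) (w : Place F L) :
    (∑ v ∈ T, e v • ({v} : Multiset (Place F L))).count w = if w ∈ T then e w else 0 := by
  simp [Multiset.count_sum', Multiset.count_singleton]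

theorem degM_sum_nsmul (T : Finset (Place F L)) (e : Place F L → ℕ) :
    degM (∑ v ∈ T, e v • ({v} : Multiset (Place F L))) = ∑ v ∈ T, e v * v.degree := by
  classical
  induction T using Finset.induction with
  | empty => simp
  | insert v T hv ih =>
    rw [Finset.sum_insert hv, Finset.sum_insert hv, degM_add, ih, degM_nsmul]
    simp [degM]

theorem deg_divM (m : Multiset (Place F L)) :
    (Function.support fun v => divM m v * (v.degree : ℤ)).Finite ∧ deg (divM m) = degM m := by
  classical
  have hs : (Function.support fun v => divM m v * (v.degree : ℤ)) ⊆ m.toFinset := by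
    intro v hv
    simp only [Function.mem_support, divM] at hv
    have : m.count v ≠ 0 := fun h => hv (by simp [h])
    simpa using Multiset.count_ne_zero.1 this
  refine ⟨m.toFinset.finite_toSet.subset hs, ?_⟩
  rw [deg, finsum_eq_sum_of_support_subset _ hs, degM, Finset.sum_multiset_map_count]
  simp [divM]

/-- A nonzero `x` with a zero is transcendental, so `x⁻¹` has a zero as well, which is a pole of
`x`. -/
theorem eq_zero_of_val_le_one [IsFunctionField F L] {x : L} (h : ∀ v : Place F L, v.val x ≤ 1) {v : Place F L}
    (hv : v.val x < 1) : x = 0 := by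
  by_contra h0
  have ht := transcendental_inv (v.transcendental_of_ordInt_ne_zero ((v.val_lt_one_iff h0).1 hv).ne')
  obtain ⟨w, hw⟩ := exists_place_ordInt_pos ht
  have h1 := h w
  rw [← WithZero.exp_zero, w.val_le_exp_iff h0] at h1
  rw [Place.ordInt_inv] at hw
  omega

theorem exists_place [IsFunctionField F L] : Nonempty (Place F L) := by
  obtain ⟨y, hy⟩ := IsFunctionField.exists_transcendental (F := F) (L := L)
  obtain ⟨v, -⟩ := exists_place_ordInt_pos hy
  exact ⟨v⟩

end

variable {F L : Type*} [Field F] [Fintype F] [Field L] [Algebra F L] [IsFunctionField F L]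

/-- The degree of the zero divisor of `y`, on any finite set of zeros, is at most `[L : F(y)]`. -/
theorem sum_ordInt_mul_degree_le {y : L} (hy : Transcendental F y) (T : Finset (Place F L))
    (hT : ∀ v ∈ T, 0 < v.ordInt y) :
    ∑ v ∈ T, (v.ordInt y).toNat * v.degree ≤ Module.finrank F⟮y⟯ L := by
  classical
  have hy0 := ne_zero_of_transcendental hy
  have := IsFunctionField.finite_adjoin _ hy
  let m : Multiset (Place F L) := ∑ v ∈ T, (v.ordInt y).toNat • {v}
  have hcount : ∀ v ∈ T, (m.count v : ℤ) = v.ordInt y := fun v hv => by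
    rw [count_sum_nsmul, if_pos hv, Int.toNat_of_nonneg (hT v hv).le]
  have hm : ∀ v ∈ m, v ∈ (T : Set (Place F L)) := by
    intro v hv
    by_contra h
    have h1 : m.count v = 0 := by rw [count_sum_nsmul, if_neg (show v ∉ T from h)]
    exact absurd hv (Multiset.count_eq_zero.1 h1)
  -- Let `A` be the functions regular on `T`, and `B` those vanishing on `T` at least to the order
  -- of `y`. As `T` is finite, `A/B` has exactly `q ^ deg` elements; as `yA ⊆ B`, its dimension is
  -- at most `[L : F(y)]`.
  obtain ⟨-, -, h3⟩ := relIndex_boundedOn (T : Set (Place F L)) (-divM m) m hm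
  have h3 := h3 T.finite_toSet
  rw [neg_add_cancel] at h3
  let A := boundedOn (T : Set (Place F L)) 0
  let B := boundedOn (T : Set (Place F L)) (-divM m)
  have hyA : ∀ a ∈ A, y * a ∈ B := by
    intro a ha v hv
    rw [map_mul, v.val_eq_exp hy0]
    have h1 := ha v hv
    rw [Pi.zero_apply, WithZero.exp_zero] at h1
    refine (mul_le_of_le_one_right' h1).trans ?_
    rw [WithZero.exp_le_exp, Pi.neg_apply, divM, hcount v hv]
  have hBA : B ≤ A := boundedOn_mono _ (neg_nonpos.2 (divM_nonneg m))
  obtain ⟨hfin, hle⟩ := finite_and_finrank_le_of_surjective hy A (fun a ha => hBA (hyA a ha))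
    (B.submoduleOf A).mkQ (Submodule.mkQ_surjective _) (fun a => by
      rw [Submodule.mkQ_apply, Submodule.Quotient.mk_eq_zero]
      exact hyA a a.2)
  have hcard : B.toAddSubgroup.relIndex A.toAddSubgroup
      = Fintype.card F ^ Module.finrank F (A ⧸ B.submoduleOf A) := by
    rw [← Nat.card_eq_fintype_card, ← Module.natCard_eq_pow_finrank (K := F)]
    rfl
  rw [hcard] at h3
  have h4 := Nat.pow_right_injective (Fintype.one_lt_card : 1 < Fintype.card F) h3
  rw [degM_sum_nsmul] at h4
  rw [← h4]
  exact hle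

/-- Each zero contributes at least `1` to a sum bounded by `[L : F(y)]`. -/
theorem finite_ordInt_pos (y : L) : {v : Place F L | 0 < v.ordInt y}.Finite := by
  by_cases hy : Transcendental F y
  · by_contra hinf
    obtain ⟨T, hT, hcard⟩ := (Set.Infinite.exists_subset_card_eq hinf
      (Module.finrank F⟮y⟯ L + 1))
    have h1 := sum_ordInt_mul_degree_le hy T fun v hv => hT hv
    have h2 : T.card ≤ ∑ v ∈ T, (v.ordInt y).toNat * v.degree := by
      rw [Finset.card_eq_sum_ones]
      refine Finset.sum_le_sum fun v hv => ?_
      have h3 : 0 < v.ordInt y := hT hv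
      exact Nat.mul_pos (by omega) v.degree_pos
    omega
  · refine Set.Finite.subset Set.finite_empty fun v hv => ?_
    exact hy (v.transcendental_of_ordInt_ne_zero (ne_of_gt hv))

theorem finite_ordInt_ne_zero (y : L) : {v : Place F L | v.ordInt y ≠ 0}.Finite := by
  refine ((finite_ordInt_pos y).union (finite_ordInt_pos y⁻¹)).subset fun v hv => ?_
  have h : v.ordInt y ≠ 0 := hv
  change 0 < v.ordInt y ∨ 0 < v.ordInt y⁻¹
  rw [Place.ordInt_inv]
  omega

/-- The zero divisor of an element. -/
def zeros (y : L) : Multiset (Place F L) :=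
  ∑ v ∈ (finite_ordInt_pos (F := F) y).toFinset, (v.ordInt y).toNat • {v}

theorem divM_zeros (y : L) (v : Place F L) : divM (zeros y) v = max (v.ordInt y) 0 := by
  classical
  rw [divM, zeros, count_sum_nsmul]
  split_ifs with h
  · rw [Int.ofNat_toNat]
  · have : ¬ 0 < v.ordInt y := by simpa using h
    simp; omega

theorem divM_zeros_sub (y : L) (v : Place F L) :
    v.ordInt y = divM (zeros y) v - divM (zeros y⁻¹) v := by
  rw [divM_zeros, divM_zeros, Place.ordInt_inv]
  omega

theorem degM_zeros_le {y : L} (hy : Transcendental F y) :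
    degM (zeros (F := F) y) ≤ Module.finrank F⟮y⟯ L := by
  rw [zeros, degM_sum_nsmul]
  exact sum_ordInt_mul_degree_le hy _ fun v hv => by simpa using hv

open Classical in
/-- The Riemann–Roch space of a divisor `m - v` with `m` effective has at most `q ^ deg m`
elements. -/
theorem natCard_boundedOn_univ (m : Multiset (Place F L)) (v : Place F L) :
    Finite (boundedOn Set.univ (-Pi.single v 1 + divM m)) ∧
    Nat.card (boundedOn Set.univ (-Pi.single v 1 + divM m)) ≤ Fintype.card F ^ degM m := by
  obtain ⟨h1, h2, -⟩ := relIndex_boundedOn Set.univ (-Pi.single v 1) m fun _ _ => Set.mem_univ _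
  -- A function without poles that vanishes at `v` is zero, so the index counts the whole space.
  have hbot : (boundedOn Set.univ (-Pi.single v 1) : Submodule F L).toAddSubgroup = ⊥ := by
    rw [eq_bot_iff]
    intro x hx
    have hx' : ∀ w : Place F L, w.val x ≤ WithZero.exp ((-Pi.single v 1 : FormalDivisor F L) w) :=
      fun w => hx w (Set.mem_univ w)
    refine eq_zero_of_val_le_one (fun w => (hx' w).trans ?_) (v := v) ((hx' v).trans_lt ?_)
    · rw [← WithZero.exp_zero, WithZero.exp_le_exp, Pi.neg_apply, neg_nonpos]
      exact (Pi.single_nonneg.2 zero_le_one : (0 : FormalDivisor F L) ≤ Pi.single v 1) w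
    · rw [← WithZero.exp_zero, WithZero.exp_lt_exp]; simp
  rw [hbot, AddSubgroup.relIndex_bot_left] at h1 h2
  exact ⟨Nat.finite_of_card_ne_zero h1, h2⟩

/-- With a basis `u_i` of `L` over `F(y)`, the sums `∑ p_i(y) u_i` with `deg p_i ≤ l` form an `n(l +
1)`-dimensional space whose poles are bounded by `l` times those of `y` plus a fixed divisor.
Counting gives `n(l + 1) ≤ l b + const`, and large `l` gives `n ≤ b`. -/
theorem finrank_le_degM_zeros_inv {y : L} (hy : Transcendental F y) :
    Module.finrank F⟮y⟯ L ≤ degM (zeros (F := F) y⁻¹) := by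
  classical
  obtain ⟨v₀⟩ := exists_place (F := F) (L := L)
  have := IsFunctionField.finite_adjoin _ hy
  set n := Module.finrank F⟮y⟯ L with hn
  set b := degM (zeros (F := F) y⁻¹) with hb
  let u := Module.finBasis F⟮y⟯ L
  -- The additional `v₀` offsets the `-v₀` in `natCard_boundedOn_univ`.
  let m₀ : Multiset (Place F L) := v₀ ::ₘ ∑ i, zeros (u i)⁻¹
  have key : ∀ l : ℕ, n * (l + 1) ≤ l * b + degM m₀ := by
    intro l
    let m := m₀ + l • zeros y⁻¹
    obtain ⟨hfin, hcard⟩ := natCard_boundedOn_univ m v₀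
    have hval : ∀ (v : Place F L) (x : L), v.val x ≤ WithZero.exp (divM (zeros x⁻¹) v) := by
      intro v x
      by_cases hx : x = 0
      · simp [hx]
      · rw [v.val_eq_exp hx, WithZero.exp_le_exp, divM_zeros, Place.ordInt_inv]
        exact le_max_left _ _
    have hmem : ∀ p : Fin n → degreeLT F (l + 1), ∑ i, aeval y (p i : F[X]) * u i ∈
        boundedOn Set.univ (-Pi.single v₀ 1 + divM m) := by
      intro p
      refine Submodule.sum_mem _ fun i _ => ?_
      have hdeg : (p i : F[X]).natDegree < l + 1 := by
        by_cases h0 : (p i : F[X]) = 0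
        · simp [h0]
        · exact (natDegree_lt_iff_degree_lt h0).2 (mem_degreeLT.1 (p i).2)
      rw [aeval_eq_sum_range' hdeg, Finset.sum_mul]
      refine Submodule.sum_mem _ fun j hj => ?_
      rw [smul_mul_assoc]
      refine Submodule.smul_mem _ _ fun v _ => ?_
      have hj' : j ≤ l := Nat.lt_succ_iff.1 (Finset.mem_range.1 hj)
      have h1 : v.val (y ^ j * u i) ≤ WithZero.exp
          (l * divM (zeros y⁻¹) v + divM (zeros (u i)⁻¹) v) := by
        rw [map_mul, map_pow, WithZero.exp_add]
        refine mul_le_mul' ?_ (hval v _)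
        calc v.val y ^ j ≤ WithZero.exp (divM (zeros y⁻¹) v) ^ j :=
              pow_le_pow_left' (hval v y) j
          _ = WithZero.exp (j * divM (zeros y⁻¹) v) := by
              rw [← WithZero.exp_nsmul, nsmul_eq_mul]
          _ ≤ _ := by
              rw [WithZero.exp_le_exp]
              exact mul_le_mul_of_nonneg_right (by exact_mod_cast hj') (divM_nonneg _ v)
      refine h1.trans (WithZero.exp_le_exp.2 ?_)
      have h2 : divM (zeros (u i)⁻¹) v ≤ divM (∑ i, zeros (u i)⁻¹) v := by
        rw [divM, divM]
        exact_mod_cast Multiset.count_le_of_le v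
          (Finset.single_le_sum (f := fun i => zeros (F := F) (u i)⁻¹)
            (fun _ _ => Multiset.zero_le _) (Finset.mem_univ i))
      have h3 : divM (l • zeros (F := F) y⁻¹) v = l * divM (zeros y⁻¹) v := by
        simp [divM, Multiset.count_nsmul]
      have h4 : (-Pi.single v₀ 1 + divM m : FormalDivisor F L) v
          = divM (∑ i, zeros (u i)⁻¹) v + divM (l • zeros y⁻¹) v := by
        simp only [m, m₀, divM_add, divM_cons, Pi.add_apply, Pi.neg_apply]
        ring
      rw [h4, h3]
      linarith
    have hinj : Function.Injective (fun p : Fin n → degreeLT F (l + 1) =>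
        (⟨_, hmem p⟩ : boundedOn Set.univ (-Pi.single v₀ 1 + divM m))) := by
      intro p p' h
      have h1 : ∑ i, aeval y (p i : F[X]) * u i = ∑ i, aeval y (p' i : F[X]) * u i :=
        congrArg Subtype.val h
      have h2 := (linearIndependent_adjoin_iff hy u).1 u.linearIndependent
        (fun i => (p i : F[X]) - (p' i : F[X])) (by
          simp only [map_sub, sub_mul, Finset.sum_sub_distrib]
          exact sub_eq_zero.2 h1)
      funext i
      exact Subtype.ext (sub_eq_zero.1 (congrFun h2 i))
    have h5 := (Nat.card_le_card_of_injective _ hinj).trans hcard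
    have h6 : Nat.card (Fin n → degreeLT F (l + 1)) = Fintype.card F ^ (n * (l + 1)) := by
      rw [Nat.card_congr (Equiv.piCongrRight fun _ => (degreeLTEquiv F (l + 1)).toEquiv)]
      simp [← pow_mul, mul_comm]
    rw [h6] at h5
    have h7 := (Nat.pow_le_pow_iff_right (Fintype.one_lt_card : 1 < Fintype.card F)).1 h5
    have h8 : degM m = l * b + degM m₀ := by
      simp only [m, degM_add, degM_nsmul, ← hb]; ring
    omega
  by_contra hlt
  push Not at hlt
  -- If `b ≤ n - 1`, then `l = deg m₀` gives `n(l + 1) ≤ l(n - 1) + l = ln`, which is absurd.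
  have h1 := key (degM m₀)
  have h2 : degM m₀ * b ≤ degM m₀ * (n - 1) := Nat.mul_le_mul_left _ (by omega)
  obtain ⟨k, hk⟩ : ∃ k, n = k + 1 := ⟨n - 1, by omega⟩
  rw [hk] at h1 h2
  simp only [Nat.add_sub_cancel] at h2
  nlinarith

/-- The chain `deg zeros ≤ [L : F(y)] ≤ deg poles` holds for `y` and for `y⁻¹`; algebraic elements
have neither zeros nor poles. -/
theorem degM_zeros_eq_degM_zeros_inv (y : L) :
    degM (zeros (F := F) y) = degM (zeros (F := F) y⁻¹) := by
  by_cases hy : Transcendental F y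
  · refine le_antisymm ((degM_zeros_le hy).trans (finrank_le_degM_zeros_inv hy)) ?_
    have h1 := degM_zeros_le (transcendental_inv hy)
    have h2 := finrank_le_degM_zeros_inv (transcendental_inv hy)
    rw [inv_inv] at h2
    exact h1.trans h2
  · have hy' : IsAlgebraic F y := not_not.1 hy
    have h : ∀ x : L, IsAlgebraic F x → zeros (F := F) x = 0 := by
      classical
      intro x hx
      ext v
      have := divM_zeros x v
      rw [v.ordInt_eq_zero_of_isAlgebraic hx, divM] at this
      simpa using this
    rw [h y hy', h _ hy'.inv]

/-- The product formula. -/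
theorem deg_ordInt (y : L) : deg (fun v : Place F L => v.ordInt y) = 0 := by
  obtain ⟨h1, h2⟩ := deg_divM (zeros (F := F) y)
  obtain ⟨h3, h4⟩ := deg_divM (zeros (F := F) y⁻¹)
  rw [deg] at h2 h4 ⊢
  simp only [divM_zeros_sub y, sub_mul]
  rw [finsum_sub_distrib h1 h3, h2, h4, degM_zeros_eq_degM_zeros_inv, sub_self]

theorem finiteDimensional_riemannRochSpace {D : FormalDivisor F L}
    (hD : (Function.support D).Finite) : FiniteDimensional F (riemannRochSpace D) := by
  classical
  obtain ⟨v₀⟩ := exists_place (F := F) (L := L)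
  let m : Multiset (Place F L) := v₀ ::ₘ ∑ v ∈ hD.toFinset, (D v).toNat • {v}
  obtain ⟨hfin, -⟩ := natCard_boundedOn_univ m v₀
  have hle : D ≤ -Pi.single v₀ 1 + divM m := by
    intro v
    have h1 : (-Pi.single v₀ 1 + divM m : FormalDivisor F L) v
        = divM (∑ v ∈ hD.toFinset, (D v).toNat • {v}) v := by
      simp only [m, divM_cons, Pi.add_apply, Pi.neg_apply]
      ring
    rw [h1, divM, count_sum_nsmul]
    split_ifs with h
    · exact Int.self_le_toNat _
    · have : D v = 0 := by simpa using h
      simp [this]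
  have := boundedOn_mono Set.univ hle
  rw [boundedOn_univ D] at this
  have := Module.Finite.of_finite (R := F) (M := boundedOn Set.univ (-Pi.single v₀ 1 + divM m))
  exact Submodule.finiteDimensional_of_le ‹riemannRochSpace D ≤ _›

end Drinfeld

end

noncomputable section

namespace Drinfeld

open Polynomial

/-! ### Twisted polynomials as additive polynomials -/

theorem add_pow_card_pow (F : Type*) {A : Type*} [Field F] [Fintype F] [CommRing A] [Algebra F A]
    (a b : A) (n : ℕ) : (a + b) ^ (Fintype.card F ^ n) =
      a ^ (Fintype.card F ^ n) + b ^ (Fintype.card F ^ n) := by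
  induction n with
  | zero => simp
  | succ n ih =>
    rw [pow_succ, pow_mul, pow_mul, pow_mul, ih]
    exact map_add (FiniteField.frobeniusAlgHom F A) _ _

namespace TwistedPoly

variable {F L : Type*} [Field F] [Fintype F] [Field L] [Algebra F L]

/-- The monomial `a τ ^ n`. -/
def mono (n : ℕ) (a : L) : TwistedPoly F L := SkewPolynomial.monomial (R := L) n a

/-- The additive polynomial `∑ c_n X ^ (q ^ n)` of `u = ∑ c_n τ ^ n`. -/
def toPoly (u : TwistedPoly F L) : L[X] :=
  SkewPolynomial.sum (R := L) u fun n c => Polynomial.C c * X ^ (Fintype.card F ^ n)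

theorem toPoly_add (u w : TwistedPoly F L) : (u + w).toPoly = u.toPoly + w.toPoly :=
  SkewMonoidAlgebra.sum_add_index' (k := L) (f := u) (g := w) (fun n => by simp)
    (fun n a b => by simp only [Polynomial.C_add, add_mul])

@[simp] theorem toPoly_zero : (0 : TwistedPoly F L).toPoly = 0 := by
  have h := toPoly_add (0 : TwistedPoly F L) 0
  rw [add_zero] at h
  exact left_eq_add.1 h

theorem toPoly_def (u : TwistedPoly F L) : u.toPoly =
    ∑ n ∈ SkewPolynomial.support (R := L) u, Polynomial.C (u.coeff n) * X ^ (Fintype.card F ^ n) :=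
  SkewPolynomial.sum_def (R := L) u _

theorem eval_def (u : TwistedPoly F L) (x : L) : u.eval x =
    ∑ n ∈ SkewPolynomial.support (R := L) u, u.coeff n * x ^ (Fintype.card F ^ n) :=
  SkewPolynomial.sum_def (R := L) u _

@[simp] theorem toPoly_mono (n : ℕ) (a : L) :
    (mono n a : TwistedPoly F L).toPoly = Polynomial.C a * X ^ (Fintype.card F ^ n) :=
  SkewPolynomial.sum_monomial_index (by simp)

theorem mono_mul_mono (n m : ℕ) (a b : L) : (mono n a * mono m b : TwistedPoly F L) =
    mono (n + m) (a * b ^ (Fintype.card F ^ n)) := by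
  let := frobeniusAction F L
  have h := SkewPolynomial.monomial_mul_monomial (R := L) n m a b
  rw [SkewPolynomial.φ_iterate_apply] at h
  refine h.trans ?_
  rw [show Multiplicative.ofAdd n • b = b ^ (Fintype.card F ^ n) from frobeniusAction_smul F L n b]
  rfl

theorem induction_on {motive : TwistedPoly F L → Prop} (u : TwistedPoly F L) (zero : motive 0)
    (add : ∀ u w, motive u → motive w → motive (u + w)) (mono : ∀ n a, motive (mono n a)) :
    motive u :=
  SkewPolynomial.induction (R := L) (motive := motive) u zero
    fun n a w _ _ hw => add _ w (mono n a) hw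

theorem toPoly_comp_add (u : TwistedPoly F L) (f g : L[X]) :
    u.toPoly.comp (f + g) = u.toPoly.comp f + u.toPoly.comp g := by
  induction u using induction_on with
  | zero => simp
  | add u w hu hw => rw [toPoly_add, add_comp, add_comp, add_comp, hu, hw]; ring
  | mono n a =>
    simp only [toPoly_mono, mul_comp, C_comp, pow_comp, X_comp]
    rw [add_pow_card_pow F, mul_add]

@[simp] theorem toPoly_comp_zero (u : TwistedPoly F L) : u.toPoly.comp 0 = 0 := by
  have := toPoly_comp_add u 0 0
  rw [add_zero] at this
  exact left_eq_add.1 this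

/-- Both sides are additive in `u` and in `w`, so monomials suffice. Computations in `L[τ]` thereby
become compositions of ordinary polynomials. -/
theorem toPoly_mul (u w : TwistedPoly F L) : (u * w).toPoly = u.toPoly.comp w.toPoly := by
  induction u using induction_on with
  | zero => rw [zero_mul, toPoly_zero, zero_comp]
  | add u u' hu hu' => rw [add_mul, toPoly_add, toPoly_add, add_comp, hu, hu']
  | mono n a =>
    induction w using induction_on with
    | zero => rw [mul_zero, toPoly_zero, toPoly_comp_zero]
    | add w w' hw hw' => rw [mul_add, toPoly_add, toPoly_add, toPoly_comp_add, hw, hw']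
    | mono m b =>
      rw [mono_mul_mono]
      simp only [toPoly_mono, mul_comp, C_comp, pow_comp, X_comp, Polynomial.C_mul,
        Polynomial.C_pow]
      rw [mul_pow, ← pow_mul, pow_add, mul_assoc, mul_comm (Fintype.card F ^ n)]

theorem C_eq_mono (a : L) : C F L a = mono 0 a := rfl

@[simp] theorem toPoly_C (a : L) : (C F L a).toPoly = Polynomial.C a * X := by
  rw [C_eq_mono, toPoly_mono]; simp

@[simp] theorem toPoly_one : (1 : TwistedPoly F L).toPoly = X := by
  rw [← map_one (C F L), toPoly_C]; simp

theorem eval_eq_eval_toPoly (u : TwistedPoly F L) (x : L) : u.eval x = u.toPoly.eval x := by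
  rw [eval_def, toPoly_def, eval_finsetSum]
  simp

theorem coeff_mono (n m : ℕ) (a : L) :
    (mono n a : TwistedPoly F L).coeff m = if n = m then a else 0 := by
  change SkewMonoidAlgebra.coeff (SkewMonoidAlgebra.single (Multiplicative.ofAdd n) a)
    (Multiplicative.ofAdd m) = _
  classical
  rw [SkewMonoidAlgebra.coeff_single_apply]
  simp

theorem coeff_add (u w : TwistedPoly F L) (n : ℕ) : (u + w).coeff n = u.coeff n + w.coeff n :=
  DFunLike.congr_fun (SkewMonoidAlgebra.coeff_add (k := L) (G := Multiplicative ℕ) u w) (Multiplicative.ofAdd n)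

theorem coeff_toPoly (u : TwistedPoly F L) (n : ℕ) :
    u.toPoly.coeff (Fintype.card F ^ n) = u.coeff n := by
  induction u using induction_on with
  | zero => rw [toPoly_zero, Polynomial.coeff_zero]; rfl
  | add u w hu hw => rw [toPoly_add, Polynomial.coeff_add, coeff_add, hu, hw]
  | mono m a =>
    rw [toPoly_mono, coeff_mono, coeff_C_mul_X_pow]
    simp only [(Nat.pow_right_injective (Fintype.one_lt_card : 1 < Fintype.card F)).eq_iff,
      eq_comm]

theorem toPoly_eq_sum (u : TwistedPoly F L) : u.toPoly =
    ∑ n ∈ Finset.range (u.natDegree + 1), Polynomial.C (u.coeff n) * X ^ (Fintype.card F ^ n) := by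
  rw [toPoly_def]
  refine Finset.sum_subset (fun n hn => ?_) fun n _ hn => ?_
  · rw [Finset.mem_range]
    exact Nat.lt_succ_of_le (Finset.le_sup (f := id) hn)
  · have h0 : u.coeff n = 0 := SkewPolynomial.notMem_support_iff.1 hn
    rw [h0]; simp

theorem coeff_eq_zero_of_natDegree_lt (u : TwistedPoly F L) {n : ℕ} (h : u.natDegree < n) :
    u.coeff n = 0 := by
  by_contra h0
  have : n ∈ SkewPolynomial.support (R := L) u := SkewPolynomial.mem_support_iff.2 h0
  exact absurd (Finset.le_sup (f := id) this) (not_le.2 h)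

theorem coeff_natDegree_ne_zero (u : TwistedPoly F L) (h : u.natDegree ≠ 0) :
    u.coeff u.natDegree ≠ 0 := by
  have hne : (SkewPolynomial.support (R := L) u).Nonempty := by
    by_contra h0
    rw [Finset.not_nonempty_iff_eq_empty] at h0
    exact h (by rw [natDegree, h0]; rfl)
  obtain ⟨n, hn, he⟩ := Finset.exists_mem_eq_sup _ hne id
  rw [natDegree, he]
  exact SkewPolynomial.mem_support_iff.1 hn

/-- The units of `L[τ]` are constants. -/
theorem exists_toPoly_eq_of_mul_eq_one {u u' : TwistedPoly F L} (h : u * u' = 1) :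
    ∃ c : L, c ≠ 0 ∧ u.toPoly = Polynomial.C c * X := by
  have h1 := congrArg toPoly h
  rw [toPoly_mul, toPoly_one] at h1
  -- Degrees multiply under composition, so `u` has degree `1`; additivity removes its constant
  -- term.
  have h2 := congrArg Polynomial.natDegree h1
  rw [natDegree_comp, natDegree_X] at h2
  have h3 : u.toPoly.natDegree = 1 := Nat.eq_one_of_mul_eq_one_right h2
  have h4 := toPoly_comp_zero u
  rw [comp_zero, C_eq_zero, ← coeff_zero_eq_eval_zero] at h4
  refine ⟨u.toPoly.coeff 1, ?_, ?_⟩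
  · intro h0
    rw [← h3, coeff_natDegree, leadingCoeff_eq_zero] at h0
    rw [h0, natDegree_zero] at h3
    exact zero_ne_one h3
  · conv_lhs => rw [eq_X_add_C_of_natDegree_le_one h3.le]
    rw [h4]; simp

end TwistedPoly

/-! ### The action of `F[t]` on points -/

namespace DrinfeldModule

variable {F L : Type*} [Field F] [Fintype F] [Field L] [Algebra F L] [Algebra (RatFunc F) L]

theorem act_add (E : DrinfeldModule F L) (a b : F[X]) (x : L) :
    E.act (a + b) x = E.act a x + E.act b x := by
  simp only [act, TwistedPoly.eval_eq_eval_toPoly]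
  rw [map_add, TwistedPoly.toPoly_add, eval_add]

theorem act_mul (E : DrinfeldModule F L) (a b : F[X]) (x : L) :
    E.act (a * b) x = E.act a (E.act b x) := by
  simp only [act, TwistedPoly.eval_eq_eval_toPoly]
  rw [map_mul, TwistedPoly.toPoly_mul, eval_comp]

theorem act_C (E : DrinfeldModule F L) (c : F) (x : L) : E.act (C c) x = c • x := by
  simp only [act, TwistedPoly.eval_eq_eval_toPoly]
  have : E.φ (C c) = TwistedPoly.C F L (algebraMap F L c) := E.φ.commutes c
  rw [this, TwistedPoly.toPoly_C, Algebra.smul_def]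
  simp

theorem act_point_add (E : DrinfeldModule F L) (a : F[X]) (x y : L) :
    E.act a (x + y) = E.act a x + E.act a y := by
  simp only [act, TwistedPoly.eval_eq_eval_toPoly]
  have := congrArg (Polynomial.eval 0)
    (TwistedPoly.toPoly_comp_add (E.φ a) (Polynomial.C x) (Polynomial.C y))
  simpa [eval_comp] using this

/-- If `φ_t` were a constant, all `φ_a` would be polynomials of degree at most `1`, against
`not_const`. -/
theorem rank_pos (E : DrinfeldModule F L) : 0 < E.rank := by
  by_contra h
  have h0 : (E.φ X).natDegree = 0 := by
    change ¬ 0 < (E.φ X).natDegree at h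
    omega
  have hlin : ∀ a : F[X], (E.φ a).toPoly.natDegree ≤ 1 := by
    intro a
    induction a using Polynomial.induction_on with
    | C c =>
      have : E.φ (C c) = TwistedPoly.C F L (algebraMap F L c) := E.φ.commutes c
      rw [this, TwistedPoly.toPoly_C]
      exact (natDegree_C_mul_le _ X).trans natDegree_X_le
    | add a b ha hb =>
      rw [map_add, TwistedPoly.toPoly_add]
      exact (natDegree_add_le _ _).trans (max_le ha hb)
    | monomial n c ih =>
      rw [pow_succ, ← mul_assoc, map_mul, TwistedPoly.toPoly_mul, natDegree_comp]
      have : (E.φ X).toPoly.natDegree ≤ 1 := by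
        rw [TwistedPoly.toPoly_eq_sum, h0]
        simpa using (natDegree_C_mul_le _ X).trans natDegree_X_le
      exact Nat.mul_le_mul ih this
  refine E.not_const fun a n hn => ?_
  rw [← TwistedPoly.coeff_toPoly]
  refine coeff_eq_zero_of_natDegree_lt (lt_of_le_of_lt (hlin a) ?_)
  exact Nat.one_lt_pow hn.ne' Fintype.one_lt_card

theorem κ_rank_ne_zero (E : DrinfeldModule F L) : E.κ E.rank ≠ 0 :=
  TwistedPoly.coeff_natDegree_ne_zero _ E.rank_pos.ne'

theorem κ_zero (E : DrinfeldModule F L) : E.κ 0 = theta F L := E.coeff_zero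

theorem act_X (E : DrinfeldModule F L) (x : L) :
    E.act X x = ∑ j ∈ Finset.range (E.rank + 1), E.κ j * x ^ (Fintype.card F ^ j) := by
  rw [act, TwistedPoly.eval_eq_eval_toPoly, TwistedPoly.toPoly_eq_sum, eval_finsetSum]
  simp [rank, κ]

end DrinfeldModule

end Drinfeld

end

noncomputable section

namespace Drinfeld

open Polynomial

/-! ### Generators of bounded degree -/

/-- An increasing chain of subspaces of a space of dimension `d` that is constant once it is
stationary has its largest term at the index `d`. -/
theorem chain_le_of_finrank {F M : Type*} [Field F] [AddCommGroup M] [Module F M]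
    {V : Submodule F M} [FiniteDimensional F V] (A : ℕ → Submodule F M) (hmono : Monotone A)
    (hV : ∀ j, A j ≤ V) (hstat : ∀ j, A (j + 1) ≤ A j → A (j + 2) ≤ A (j + 1)) (j : ℕ) :
    A j ≤ A (Module.finrank F V) := by
  set d := Module.finrank F V
  have hex : ∃ k ≤ d, A (k + 1) ≤ A k := by
    by_contra h
    push Not at h
    have hfin : ∀ k, FiniteDimensional F (A k) := fun k => Submodule.finiteDimensional_of_le (hV k)
    -- Strict growth at each of the indices `0, …, d` would force dimension `d + 1` inside `V`.
    have hge : ∀ k ≤ d + 1, k ≤ Module.finrank F (A k) := by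
      intro k
      induction k with
      | zero => intro _; exact Nat.zero_le _
      | succ k ih =>
        intro hk
        have h1 := ih (by omega)
        have h2 := Submodule.finrank_lt_finrank_of_lt
          (lt_of_le_not_ge (hmono (Nat.le_succ k)) (h k (by omega)))
        exact lt_of_le_of_lt h1 h2
    have h1 := hge (d + 1) le_rfl
    have h2 := Submodule.finrank_mono (hV (d + 1))
    omega
  obtain ⟨k, hk, hle⟩ := hex
  have hst : ∀ i, A (k + i + 1) ≤ A (k + i) := by
    intro i
    induction i with
    | zero => exact hle
    | succ i ih => exact hstat _ ih
  have hall : ∀ i, A (k + i) ≤ A k := by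
    intro i
    induction i with
    | zero => exact le_rfl
    | succ i ih => exact (hst i).trans ih
  exact ((hmono (Nat.le_add_left j k)).trans (hall j)).trans (hmono hk)

/-- Let `ev : F[X]^ι → M` be a linear map under which multiplication by `X` corresponds to an
operator `T` of `M`, and let `V` be a subspace of dimension `d` such that `ev a ∈ V` implies
`ev ((a - a(0)) / X) ∈ V`. Then the kernel of `ev` is generated by its elements of degree at
most `d`. -/
theorem mem_span_of_ev_eq_zero {F M ι : Type*} [Field F] [AddCommGroup M] [Module F M]
    [Finite ι] (ev : (ι → F[X]) →ₗ[F] M) (T : M →ₗ[F] M)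
    (hT : ∀ a, ev ((X : F[X]) • a) = T (ev a)) (V : Submodule F M) [FiniteDimensional F V]
    (hV : ∀ a : ι → F[X], ev a ∈ V → ev (fun i => (a i).divX) ∈ V)
    (a : ι → F[X]) (ha : ev a = 0) :
    a ∈ Submodule.span F[X] {b : ι → F[X] | ev b = 0 ∧
      ∀ i, (b i).degree ≤ (Module.finrank F V : ℕ)} := by
  have := Fintype.ofFinite ι
  set d := Module.finrank F V
  have hdec : ∀ a : ι → F[X], a = (X : F[X]) • (fun i => (a i).divX) + fun i => C ((a i).coeff 0) := by
    intro a
    funext i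
    simp [X_mul_divX_add]
  have hdivX : ∀ (p : F[X]) (n : ℕ), p.degree < (n + 1 : ℕ) → p.divX.degree < (n : ℕ) := by
    intro p n hp
    rw [degree_lt_iff_coeff_zero] at hp ⊢
    intro m hm
    rw [coeff_divX]
    exact hp (m + 1) (by omega)
  have hmulX : ∀ (p : F[X]) (c : F) (n : ℕ), p.degree < (n : ℕ) →
      degree (X * p + C c : F[X]) < ((n + 1 : ℕ) : WithBot ℕ) := by
    intro p c n hp
    rw [degree_lt_iff_coeff_zero] at hp ⊢
    intro m hm
    obtain ⟨k, rfl⟩ : ∃ k, m = k + 1 := ⟨m - 1, by omega⟩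
    rw [coeff_add, coeff_X_mul, coeff_C_succ, hp k (by omega), add_zero]
  let A : ℕ → Submodule F M := fun j =>
    (Submodule.pi Set.univ fun _ : ι => degreeLT F j).map ev ⊓ V
  have hA : ∀ j x, x ∈ A j ↔ (∃ a : ι → F[X], (∀ i, (a i).degree < (j : ℕ)) ∧ ev a = x) ∧ x ∈ V := by
    intro j x
    simp [A, Submodule.mem_pi, mem_degreeLT]
  have hmono : Monotone A := by
    intro j k hjk x hx
    rw [hA] at hx ⊢
    obtain ⟨⟨a, h1, h2⟩, h3⟩ := hx
    exact ⟨⟨a, fun i => (h1 i).trans_le (by exact_mod_cast hjk), h2⟩, h3⟩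
  -- The quotient `a'` of `a` by `X` still has its value in `V`; replacing it by a vector of lower
  -- degree with the same value lowers the degree of `a` without changing `ev a`.
  have hstat : ∀ j, A (j + 1) ≤ A j → A (j + 2) ≤ A (j + 1) := by
    intro j hj x hx
    rw [hA] at hx ⊢
    obtain ⟨⟨a, h1, rfl⟩, h3⟩ := hx
    have h4 : ev (fun i => (a i).divX) ∈ A (j + 1) :=
      (hA _ _).2 ⟨⟨_, fun i => hdivX _ _ (h1 i), rfl⟩, hV a h3⟩
    obtain ⟨⟨b, hb1, hb2⟩, -⟩ := (hA _ _).1 (hj h4)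
    refine ⟨⟨(X : F[X]) • b + fun i => C ((a i).coeff 0), fun i => hmulX _ _ _ (hb1 i), ?_⟩, h3⟩
    rw [map_add, hT, hb2, ← hT, ← map_add, ← hdec]
  have hd := chain_le_of_finrank (V := V) A hmono (fun j => inf_le_right) hstat
  suffices H : ∀ N : ℕ, ∀ a : ι → F[X], ev a = 0 → (∀ i, (a i).degree < (N : ℕ)) →
      a ∈ Submodule.span F[X] {b : ι → F[X] | ev b = 0 ∧ ∀ i, (b i).degree ≤ (d : ℕ)} by
    refine H (Finset.univ.sup (fun i => (a i).natDegree) + 1) a ha fun i => ?_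
    refine lt_of_le_of_lt degree_le_natDegree ?_
    have := Finset.le_sup (f := fun i => (a i).natDegree) (Finset.mem_univ i)
    exact_mod_cast Nat.lt_succ_of_le this
  intro N
  induction N with
  | zero =>
    intro a _ hdeg
    have : a = 0 := by
      funext i
      have := hdeg i
      simpa [Nat.WithBot.lt_zero_iff] using this
    rw [this]
    exact Submodule.zero_mem _
  | succ N ih =>
    intro a ha hdeg
    by_cases hN : N ≤ d
    · refine Submodule.subset_span ⟨ha, fun i => ?_⟩
      have h1 := hdeg i
      rw [degree_lt_iff_coeff_zero] at h1
      rw [degree_le_iff_coeff_zero]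
      intro m hm
      have hm' : d < m := by exact_mod_cast hm
      exact h1 m (by omega)
    -- Here `N > d`, so the value of `a'` is also that of some `b` of degree `< d`. The relation `b'
    -- = X b + a(0)` has degree at most `d`, and `a - b'` is `X` times the relation `a' - b`,
    -- covered by induction.
    · have h1 : ev (fun i => (a i).divX) ∈ A N :=
        (hA _ _).2 ⟨⟨_, fun i => hdivX _ _ (hdeg i), rfl⟩, hV a (ha ▸ V.zero_mem)⟩
      obtain ⟨⟨b, hb1, hb2⟩, -⟩ := (hA _ _).1 (hd N h1)
      let b' : ι → F[X] := (X : F[X]) • b + fun i => C ((a i).coeff 0)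
      have hb' : ev b' = 0 := by
        rw [map_add, hT, hb2, ← hT, ← map_add, ← hdec, ha]
      have hsub : a = b' + (X : F[X]) • ((fun i => (a i).divX) - b) := by
        conv_lhs => rw [hdec a]
        rw [smul_sub]
        simp only [b']
        abel
      rw [hsub]
      refine Submodule.add_mem _ (Submodule.subset_span ⟨hb', fun i => ?_⟩)
        (Submodule.smul_mem _ _ (ih _ ?_ fun i => ?_))
      · have h2 := hmulX (b i) ((a i).coeff 0) d (hb1 i)
        rw [degree_lt_iff_coeff_zero] at h2
        rw [degree_le_iff_coeff_zero]
        intro m hm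
        have hm' : d < m := by exact_mod_cast hm
        exact h2 m hm'
      · rw [map_sub, hb2, sub_self]
      · refine lt_of_le_of_lt (degree_sub_le _ _) (max_lt (hdivX _ _ (hdeg i)) ?_)
        exact (hb1 i).trans_le (by exact_mod_cast (not_le.1 hN).le)

/-- As `F` is finite, all relations of bounded degree together can serve as a finite list of
generators. -/
theorem finite_degree_le (F : Type*) [Field F] [Finite F] (ι : Type*) [Finite ι] (n : ℕ) :
    {a : ι → F[X] | ∀ i, (a i).degree ≤ n}.Finite := by
  have h : (degreeLT F (n + 1) : Set F[X]).Finite := by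
    have : Finite (degreeLT F (n + 1)) :=
      Finite.of_equiv _ (degreeLTEquiv F (n + 1)).symm.toEquiv
    exact Set.toFinite _
  refine (Set.Finite.pi fun _ : ι => h).subset fun a ha i _ => ?_
  exact mem_degreeLT.2 ((ha i).trans_lt (by exact_mod_cast Nat.lt_succ_self n))

end Drinfeld

end

noncomputable section

namespace Drinfeld

open Polynomial

/-! ### The Newton polygon of a Drinfeld module -/

section Slope

variable {F L : Type*} [Field F] [Field L] [Algebra F L]

/-- The last slope is determined by the property in `lastSlope_spec`. -/
theorem lastSlope_eq (v : Place F L) (f : L[X][X])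
    (h : (f.support.erase f.natDegree).Nonempty) {s : ℚ}
    (h1 : ∀ n ∈ f.support, (((v.ordPoly (f.coeff f.natDegree)).untopD 0 : ℤ) : ℚ)
        - s * ((f.natDegree : ℚ) - (n : ℚ)) ≤ ((v.ordPoly (f.coeff n)).untopD 0 : ℤ))
    (h2 : ∃ n ∈ f.support, n < f.natDegree ∧ (((v.ordPoly (f.coeff f.natDegree)).untopD 0 : ℤ) : ℚ)
        - s * ((f.natDegree : ℚ) - (n : ℚ)) = ((v.ordPoly (f.coeff n)).untopD 0 : ℤ)) :
    lastSlope v f = s := by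
  obtain ⟨k1, m, hm, hlt', k2⟩ := lastSlope_spec v f h
  obtain ⟨n, hn, hlt, h2⟩ := h2
  have a1 := h1 m hm
  have a2 := k1 n hn
  have b1 : (0 : ℚ) < (f.natDegree : ℚ) - m := sub_pos.2 (by exact_mod_cast hlt')
  have b2 : (0 : ℚ) < (f.natDegree : ℚ) - n := sub_pos.2 (by exact_mod_cast hlt)
  refine le_antisymm (le_of_mul_le_mul_right ?_ b1) (le_of_mul_le_mul_right ?_ b2) <;> linarith

theorem untopD_ordPoly_C (v : Place F L) (a : L) :
    (v.ordPoly (C a)).untopD 0 = v.ordInt a := by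
  by_cases h : a = 0
  · simp [h, Place.ordPoly]
  · rw [Place.ordPoly, support_C h, Finset.inf_singleton, coeff_C_zero, v.untopD_ord]

theorem untopD_ordPoly_X_sub_C (v : Place F L) {a : L} (ha : a ≠ 0) :
    (v.ordPoly (X - C a)).untopD 0 = min (v.ordInt a) 0 := by
  have hs : (X - C a).support = {0, 1} := by
    ext n
    rw [mem_support_iff, coeff_sub, coeff_X, coeff_C]
    rcases n with _ | _ | n <;> simp [ha]
  rw [Place.ordPoly, hs, Finset.inf_insert, Finset.inf_singleton]
  have h0 : (X - C a).coeff 0 = -a := by simp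
  have h1 : (X - C a).coeff 1 = 1 := by simp
  rw [h0, h1, v.ord_of_ne_zero (neg_ne_zero.2 ha), v.ord_of_ne_zero one_ne_zero, v.ordInt_neg,
    v.ordInt_one, ← WithTop.coe_min]
  rfl

end Slope

theorem theta_ne_zero {F L : Type*} [Field F] [Field L] [Algebra (RatFunc F) L] : theta F L ≠ 0 := by
  rw [theta]
  exact (_root_.map_ne_zero _).2 RatFunc.X_ne_zero

namespace DrinfeldModule

variable {F L : Type*} [Field F] [Fintype F] [Field L] [Algebra F L] [Algebra (RatFunc F) L]

theorem card_pow_injective : Function.Injective fun j : ℕ => Fintype.card F ^ j :=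
  Nat.pow_right_injective Fintype.one_lt_card

theorem coeff_assocPoly_one (E : DrinfeldModule F L) :
    E.assocPoly.coeff 1 = X - C (theta F L) := by
  rw [assocPoly, coeff_add, coeff_C_mul_X, if_pos rfl, finsetSum_coeff,
    Finset.sum_eq_zero, add_zero]
  intro j hj
  rw [coeff_C_mul_X_pow, if_neg]
  have : 1 < Fintype.card F ^ j :=
    Nat.one_lt_pow (by have := (Finset.mem_Icc.1 hj).1; omega) Fintype.one_lt_card
  omega

theorem κ_eq_zero_of_rank_lt (E : DrinfeldModule F L) {j : ℕ} (h : E.rank < j) : E.κ j = 0 :=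
  TwistedPoly.coeff_eq_zero_of_natDegree_lt _ h

theorem coeff_assocPoly_pow (E : DrinfeldModule F L) {j : ℕ} (hj : j ≠ 0) :
    E.assocPoly.coeff (Fintype.card F ^ j) = C (E.κ j) := by
  have h1 : 1 < Fintype.card F ^ j := Nat.one_lt_pow hj Fintype.one_lt_card
  rw [assocPoly, coeff_add, coeff_C_mul_X, if_neg h1.ne', zero_add, finsetSum_coeff]
  simp only [coeff_C_mul_X_pow, card_pow_injective.eq_iff]
  rw [Finset.sum_ite_eq]
  split_ifs with h
  · rfl
  · have : E.rank < j := by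
      rw [Finset.mem_Icc] at h
      omega
    rw [E.κ_eq_zero_of_rank_lt this, C_0]

theorem mem_support_assocPoly (E : DrinfeldModule F L) (n : ℕ) :
    n ∈ E.assocPoly.support ↔ n = 1 ∨ ∃ j ≠ 0, n = Fintype.card F ^ j ∧ E.κ j ≠ 0 := by
  rw [mem_support_iff]
  constructor
  · intro h
    by_contra hn
    push Not at hn
    obtain ⟨hn1, hnj⟩ := hn
    apply h
    rw [assocPoly, coeff_add, coeff_C_mul_X, if_neg hn1, zero_add, finsetSum_coeff]
    refine Finset.sum_eq_zero fun j hj => ?_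
    rw [coeff_C_mul_X_pow]
    split_ifs with hj'
    · rw [hnj j (by have := (Finset.mem_Icc.1 hj).1; omega) hj', C_0]
    · rfl
  · rintro (rfl | ⟨j, hj, rfl, hκ⟩)
    · rw [coeff_assocPoly_one]
      exact X_sub_C_ne_zero _
    · rw [coeff_assocPoly_pow E hj]
      exact C_ne_zero.2 hκ

theorem natDegree_assocPoly (E : DrinfeldModule F L) :
    E.assocPoly.natDegree = Fintype.card F ^ E.rank := by
  refine le_antisymm ?_ ?_
  · rw [natDegree_le_iff_coeff_eq_zero]
    intro n hn
    by_contra h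
    rcases (E.mem_support_assocPoly n).1 (mem_support_iff.2 h) with rfl | ⟨j, -, rfl, hκ⟩
    · exact absurd hn (not_lt.2 (Nat.one_le_pow _ _ Fintype.card_pos))
    · rw [Nat.pow_lt_pow_iff_right Fintype.one_lt_card] at hn
      exact hκ (E.κ_eq_zero_of_rank_lt hn)
  · exact le_natDegree_of_mem_supp _ ((E.mem_support_assocPoly _).2
      (Or.inr ⟨E.rank, E.rank_pos.ne', rfl, E.κ_rank_ne_zero⟩))

theorem natDegree_mem_support_assocPoly (E : DrinfeldModule F L) :
    E.assocPoly.natDegree ∈ E.assocPoly.support := by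
  rw [E.natDegree_assocPoly]
  exact (E.mem_support_assocPoly _).2 (Or.inr ⟨E.rank, E.rank_pos.ne', rfl, E.κ_rank_ne_zero⟩)

theorem nonempty_support_erase (E : DrinfeldModule F L) :
    (E.assocPoly.support.erase E.assocPoly.natDegree).Nonempty := by
  refine ⟨1, Finset.mem_erase.2 ⟨?_, (E.mem_support_assocPoly 1).2 (Or.inl rfl)⟩⟩
  rw [natDegree_assocPoly]
  exact (Nat.one_lt_pow E.rank_pos.ne' Fintype.one_lt_card).ne

/-- The order at `v` of the coefficient of `x ^ n` in the associated polynomial. -/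
def newtonHeight (E : DrinfeldModule F L) (v : Place F L) (n : ℕ) : ℤ :=
  (v.ordPoly (E.assocPoly.coeff n)).untopD 0

theorem newtonHeight_one (E : DrinfeldModule F L) (v : Place F L) :
    E.newtonHeight v 1 = min (v.ordInt (theta F L)) 0 := by
  rw [newtonHeight, coeff_assocPoly_one, untopD_ordPoly_X_sub_C v theta_ne_zero]

theorem newtonHeight_pow (E : DrinfeldModule F L) (v : Place F L) {j : ℕ} (hj : j ≠ 0) :
    E.newtonHeight v (Fintype.card F ^ j) = v.ordInt (E.κ j) := by
  rw [newtonHeight, coeff_assocPoly_pow E hj, untopD_ordPoly_C]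

/-- The line of slope `S_v` through the last point lies below the polygon; for `ord_v(x) < -S_v` the
last monomial therefore has strictly the smallest order. -/
theorem ordInt_leading_lt (E : DrinfeldModule F L) (v : Place F L) {x : L}
    (hs : (v.ordInt x : ℚ) < -lastSlope v E.assocPoly) {n : ℕ} (hn : n ∈ E.assocPoly.support)
    (hlt : n < Fintype.card F ^ E.rank) :
    v.ordInt (E.κ E.rank) + (Fintype.card F ^ E.rank : ℕ) * v.ordInt x
      < E.newtonHeight v n + n * v.ordInt x := by
  have h := (lastSlope_spec v E.assocPoly E.nonempty_support_erase).1 n hn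
  rw [natDegree_assocPoly, ← newtonHeight, ← newtonHeight, E.newtonHeight_pow v E.rank_pos.ne'] at h
  have hpos : (0 : ℚ) < ((Fintype.card F ^ E.rank : ℕ) : ℚ) - n := sub_pos.2 (by exact_mod_cast hlt)
  have h2 := mul_lt_mul_of_pos_right hs hpos
  have h3 : (v.ordInt (E.κ E.rank) : ℚ) + ((Fintype.card F ^ E.rank : ℕ) : ℚ) * v.ordInt x
      < E.newtonHeight v n + n * v.ordInt x := by linarith
  exact_mod_cast h3

/-- Points with a pole of order larger than the last slope escape to infinity. -/
theorem val_lt_val_act_X (E : DrinfeldModule F L) (v : Place F L) {x : L} (hx : x ≠ 0)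
    (hs : (v.ordInt x : ℚ) < -lastSlope v E.assocPoly) : v.val x < v.val (E.act X x) := by
  have hterm : ∀ j, E.κ j ≠ 0 → v.val (E.κ j * x ^ (Fintype.card F ^ j)) =
      WithZero.exp (-(v.ordInt (E.κ j) + (Fintype.card F ^ j : ℕ) * v.ordInt x)) := by
    intro j hj
    rw [v.val_eq_exp (mul_ne_zero hj (pow_ne_zero _ hx)), v.ordInt_mul hj (pow_ne_zero _ hx),
      v.ordInt_pow]
  -- The height at `n = 1` is `min(ord θ, 0)`. The bound by `ord θ` makes the top term dominate `θ
  -- x`, and the bound by `0` makes it dominate `x` itself; the latter is why `t - θ` replaces `θ`.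
  have hone := E.ordInt_leading_lt v hs ((E.mem_support_assocPoly 1).2 (Or.inl rfl))
    (Nat.one_lt_pow E.rank_pos.ne' Fintype.one_lt_card)
  rw [newtonHeight_one, Nat.cast_one, one_mul] at hone
  have hlead : v.val (E.act X x) = v.val (E.κ E.rank * x ^ (Fintype.card F ^ E.rank)) := by
    rw [act_X]
    refine Valuation.map_sum_eq_of_lt _ (Finset.mem_range.2 (Nat.lt_succ_self _)) fun j hj => ?_
    obtain ⟨hj1, hj2⟩ := Finset.mem_sdiff.1 hj
    have hjr : j < E.rank := by
      have h1 := Finset.mem_range.1 hj1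
      have h2 : j ≠ E.rank := fun h => hj2 (Finset.mem_singleton.2 h)
      omega
    by_cases hκ : E.κ j = 0
    · rw [hκ, zero_mul, map_zero, zero_lt_iff]
      exact v.val_ne_zero (mul_ne_zero E.κ_rank_ne_zero (pow_ne_zero _ hx))
    rw [hterm j hκ, hterm _ E.κ_rank_ne_zero, WithZero.exp_lt_exp, neg_lt_neg_iff]
    by_cases hj0 : j = 0
    · subst hj0
      rw [κ_zero, pow_zero, Nat.cast_one, one_mul]
      have := min_le_left (v.ordInt (theta F L)) 0
      omega
    · have := E.ordInt_leading_lt v hs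
        ((E.mem_support_assocPoly _).2 (Or.inr ⟨j, hj0, rfl, hκ⟩))
        ((Nat.pow_lt_pow_iff_right Fintype.one_lt_card).2 hjr)
      rwa [E.newtonHeight_pow v hj0] at this
  rw [hlead, hterm _ E.κ_rank_ne_zero, v.val_eq_exp hx, WithZero.exp_lt_exp]
  have := min_le_right (v.ordInt (theta F L)) 0
  omega

theorem mem_riemannRochSpace_of_act_X_mem (E : DrinfeldModule F L) {D : FormalDivisor F L}
    (hD : E.divSlope ≤ D) {x : L} (hx : E.act X x ∈ riemannRochSpace D) :
    x ∈ riemannRochSpace D := by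
  rw [← boundedOn_univ] at hx ⊢
  intro v hv
  by_contra h
  rw [not_le] at h
  have hx0 : x ≠ 0 := by
    rintro rfl
    rw [map_zero] at h
    exact not_lt_zero h
  refine absurd (hx v hv) (not_le.2 (h.trans (E.val_lt_val_act_X v hx0 ?_)))
  rw [v.val_eq_exp hx0, WithZero.exp_lt_exp] at h
  have h1 : (lastSlope v E.assocPoly) ≤ (⌈lastSlope v E.assocPoly⌉ : ℤ) := Int.le_ceil _
  have h2 : ((⌈lastSlope v E.assocPoly⌉ : ℤ) : ℚ) ≤ D v := by exact_mod_cast hD v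
  have h3 : (D v : ℚ) < -(v.ordInt x : ℚ) := by exact_mod_cast h
  linarith

/-- Away from the zeros and poles of the `κ_j`, including `κ_0 = θ`, every height is `0` and the
polygon is horizontal. -/
theorem finite_support_divSlope [IsFunctionField F L] (E : DrinfeldModule F L) :
    (Function.support E.divSlope).Finite := by
  have hfin : (⋃ j ∈ Finset.range (E.rank + 1), {v : Place F L | v.ordInt (E.κ j) ≠ 0}).Finite :=
    Set.Finite.biUnion (Finset.finite_toSet _) fun j _ => finite_ordInt_ne_zero _
  refine hfin.subset fun v hv => ?_
  by_contra h
  simp only [Set.mem_iUnion, Set.mem_ofPred_eq, not_exists, not_not] at h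
  have hκ : ∀ j, v.ordInt (E.κ j) = 0 := by
    intro j
    by_cases hj : j < E.rank + 1
    · exact h j (Finset.mem_range.2 hj)
    · rw [E.κ_eq_zero_of_rank_lt (by omega), v.ordInt_zero]
  have hh : ∀ n ∈ E.assocPoly.support, E.newtonHeight v n = 0 := by
    intro n hn
    rcases (E.mem_support_assocPoly n).1 hn with rfl | ⟨j, hj, rfl, -⟩
    · rw [newtonHeight_one, ← E.κ_zero, hκ]; rfl
    · rw [E.newtonHeight_pow v hj, hκ]
  obtain ⟨-, n, hn, hlt, he⟩ := lastSlope_spec v E.assocPoly E.nonempty_support_erase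
  rw [← newtonHeight, ← newtonHeight, hh n hn, natDegree_assocPoly, E.newtonHeight_pow v E.rank_pos.ne', hκ] at he
  rw [natDegree_assocPoly] at hlt
  have hpos : (0 : ℚ) < ((Fintype.card F ^ E.rank : ℕ) : ℚ) - n := sub_pos.2 (by exact_mod_cast hlt)
  have h0 : lastSlope v E.assocPoly = 0 := by
    have : lastSlope v E.assocPoly * (((Fintype.card F ^ E.rank : ℕ) : ℚ) - n) = 0 := by
      push_cast at he ⊢; linarith
    exact (mul_eq_zero.1 this).resolve_right hpos.ne'
  exact hv (by rw [divSlope, h0, Int.ceil_zero])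

/-- If the coefficients of `E'` are those of `E` twisted by `c`, then the divisors of the slopes
differ by the divisor of `c`. -/
theorem divSlope_eq_sub (E E' : DrinfeldModule F L) {c : L} (hc : c ≠ 0)
    (h : ∀ j, c * E.κ j = E'.κ j * c ^ (Fintype.card F ^ j)) (v : Place F L) :
    E'.divSlope v = E.divSlope v - v.ordInt c := by
  have hκ : ∀ j, E'.κ j ≠ 0 ↔ E.κ j ≠ 0 := by
    intro j
    rw [not_iff_not]
    have hp : c ^ (Fintype.card F ^ j) ≠ 0 := pow_ne_zero _ hc
    constructor
    · intro h0
      have := h j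
      rw [h0, zero_mul] at this
      exact (mul_eq_zero.1 this).resolve_left hc
    · intro h0
      have := h j
      rw [h0, mul_zero] at this
      exact (mul_eq_zero.1 this.symm).resolve_right hp
  have hsupp : E'.assocPoly.support = E.assocPoly.support := by
    ext n
    simp only [mem_support_assocPoly, hκ]
  -- The polygon is sheared, fixing the point at `n = 1`, so every slope drops by the integer
  -- `ord_v(c)`, which passes through the ceiling.
  have hheight : ∀ n ∈ E.assocPoly.support,
      E'.newtonHeight v n = E.newtonHeight v n + (1 - n) * v.ordInt c := by
    intro n hn
    rcases (E.mem_support_assocPoly n).1 hn with rfl | ⟨j, hj, rfl, hκj⟩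
    · rw [newtonHeight_one, newtonHeight_one]; simp
    · rw [E.newtonHeight_pow v hj, E'.newtonHeight_pow v hj]
      have h1 := congrArg v.ordInt (h j)
      rw [v.ordInt_mul hc hκj, v.ordInt_mul ((hκ j).2 hκj) (pow_ne_zero _ hc), v.ordInt_pow] at h1
      linarith
  have hN := E.natDegree_mem_support_assocPoly
  have hdeg : E'.assocPoly.natDegree = E.assocPoly.natDegree := by
    refine le_antisymm (le_natDegree_of_mem_supp _ ?_) (le_natDegree_of_mem_supp _ ?_)
    · rw [← hsupp]; exact E'.natDegree_mem_support_assocPoly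
    · rw [hsupp]; exact hN
  obtain ⟨h1, n, hn, hlt, h2⟩ := lastSlope_spec v E.assocPoly E.nonempty_support_erase
  have hslope : lastSlope v E'.assocPoly = lastSlope v E.assocPoly - (v.ordInt c : ℤ) := by
    have hn' : n ∈ E'.assocPoly.support := by rw [hsupp]; exact hn
    have hlt' : n < E'.assocPoly.natDegree := by rw [hdeg]; exact hlt
    refine lastSlope_eq v _ E'.nonempty_support_erase (fun m hm => ?_) ⟨n, hn', hlt', ?_⟩
    · rw [hsupp] at hm
      have h3 := h1 m hm
      rw [← newtonHeight, ← newtonHeight] at h3 ⊢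
      rw [hdeg, hheight _ hN, hheight m hm]
      push_cast
      linarith
    · rw [← newtonHeight, ← newtonHeight] at h2 ⊢
      rw [hdeg, hheight _ hN, hheight n hn]
      push_cast
      linarith
  rw [divSlope, divSlope, hslope, Int.ceil_sub_intCast]

end DrinfeldModule

end Drinfeld

end

noncomputable section

namespace Drinfeld

open Polynomial

/-! ### The divisor of a vector -/

section DivVec

variable {F L : Type*} [Field F] [Field L] [Algebra F L]

/-- With nonzero entries and `n > 0` the minimum is finite, so the default value of `untopD` plays
no role. -/
theorem divVec_spec {n : ℕ} (hn : 0 < n) {x : Fin n → L} (hx : ∀ i, x i ≠ 0) (v : Place F L) :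
    (∀ i, divVec x v ≤ v.ordInt (x i)) ∧ ∃ i, divVec x v = v.ordInt (x i) := by
  have : Nonempty (Fin n) := ⟨⟨0, hn⟩⟩
  obtain ⟨i, -, hi⟩ := Finset.exists_mem_eq_inf (Finset.univ : Finset (Fin n))
    Finset.univ_nonempty fun i => v.ord (x i)
  have h1 : v.ordVec x = (v.ordInt (x i) : ℤ) := by
    rw [Place.ordVec, hi, v.ord_of_ne_zero (hx i)]
  have h2 : divVec x v = v.ordInt (x i) := by
    rw [divVec, h1, WithTop.untopD_coe]
  refine ⟨fun j => ?_, i, h2⟩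
  rw [h2, ← WithTop.coe_le_coe, ← h1, ← v.ord_of_ne_zero (hx j)]
  exact Finset.inf_le (Finset.mem_univ j)

theorem divVec_mul {n : ℕ} (hn : 0 < n) {x : Fin n → L} (hx : ∀ i, x i ≠ 0) {c : L} (hc : c ≠ 0)
    (v : Place F L) : divVec (fun i => c * x i) v = divVec x v + v.ordInt c := by
  obtain ⟨h1, i, h2⟩ := divVec_spec hn hx v
  obtain ⟨k1, j, k2⟩ := divVec_spec hn (x := fun i => c * x i) (fun i => mul_ne_zero hc (hx i)) v
  have a1 := h1 j
  have a2 := k1 i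
  rw [v.ordInt_mul hc (hx _)] at a2 k2
  omega

theorem finite_support_divVec [Fintype F] [IsFunctionField F L] {n : ℕ} (hn : 0 < n)
    {x : Fin n → L} (hx : ∀ i, x i ≠ 0) :
    (Function.support (divVec x : FormalDivisor F L)).Finite := by
  refine (Set.finite_iUnion fun i => finite_ordInt_ne_zero (F := F) (x i)).subset fun v hv => ?_
  obtain ⟨i, hi⟩ := (divVec_spec hn hx v).2
  refine Set.mem_iUnion.2 ⟨i, ?_⟩
  change v.ordInt (x i) ≠ 0
  rw [← hi]
  exact hv

theorem support_mul_degree {D : FormalDivisor F L} (hD : (Function.support D).Finite) :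
    (Function.support fun v => D v * (v.degree : ℤ)).Finite :=
  hD.subset fun _ hv h => hv (by simp [h])

theorem deg_neg (D : FormalDivisor F L) : deg (-D) = -deg D := by
  simp only [deg, Pi.neg_apply, neg_mul]
  exact finsum_neg_distrib _

theorem deg_mono {D D' : FormalDivisor F L} (hD : (Function.support D).Finite)
    (hD' : (Function.support D').Finite) (h : D ≤ D') : deg D ≤ deg D' :=
  finsum_le_finsum' (support_mul_degree hD) (support_mul_degree hD')
    fun v => mul_le_mul_of_nonneg_right (h v) (by positivity)

/-- Linearly equivalent divisors have the same degree. -/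
theorem deg_sub_ordInt [Fintype F] [IsFunctionField F L] {D : FormalDivisor F L}
    (hD : (Function.support D).Finite) (c : L) :
    deg (fun v => D v - v.ordInt c) = deg D := by
  have h := deg_ordInt (F := F) c
  rw [deg] at h ⊢
  simp only [sub_mul]
  rw [finsum_sub_distrib (support_mul_degree hD) (support_mul_degree (finite_ordInt_ne_zero c)), h,
    sub_zero, deg]

end DivVec

/-! ### Relations between points, and isomorphisms -/

namespace DrinfeldModule

variable {F L : Type*} [Field F] [Fintype F] [Field L] [Algebra F L] [Algebra (RatFunc F) L]

theorem finite_support_boundDivisor [IsFunctionField F L] (E : DrinfeldModule F L) {ℓ : ℕ}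
    (hℓ : 0 < ℓ) {P : Fin ℓ → L} (hP : ∀ i, P i ≠ 0) :
    (Function.support (E.boundDivisor P)).Finite := by
  refine ((finite_support_divVec (F := F) hℓ hP).union E.finite_support_divSlope).subset
    fun v hv => ?_
  by_contra h
  rw [Set.mem_union, not_or, Function.notMem_support, Function.notMem_support] at h
  refine hv ?_
  change max (-divVec P v) (E.divSlope v) = 0
  rw [h.1, h.2]
  rfl

theorem mem_riemannRochSpace_boundDivisor (E : DrinfeldModule F L) {ℓ : ℕ}
    (hℓ : 0 < ℓ) {P : Fin ℓ → L} (hP : ∀ i, P i ≠ 0) (i : Fin ℓ) :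
    P i ∈ riemannRochSpace (E.boundDivisor P) := by
  rw [← boundedOn_univ]
  intro v _
  rw [v.val_le_exp_iff (hP i)]
  have h1 := (divVec_spec hℓ hP v).1 i
  have h2 : -divVec P v ≤ E.boundDivisor P v := le_sup_left
  omega

/-- The action of `t` on points, as an `F`-linear map. -/
def actX (E : DrinfeldModule F L) : L →ₗ[F] L where
  toFun := E.act X
  map_add' := E.act_point_add X
  map_smul' c x := by
    rw [RingHom.id_apply, ← act_C, ← act_C, ← act_mul, ← act_mul, mul_comm]

/-- The map `a ↦ ∑ φ_{a_i}(P_i)`. -/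
def evalAt (E : DrinfeldModule F L) {ℓ : ℕ} (P : Fin ℓ → L) : (Fin ℓ → F[X]) →ₗ[F] L where
  toFun a := ∑ i, E.act (a i) (P i)
  map_add' a b := by
    simp only [Pi.add_apply, act_add, Finset.sum_add_distrib]
  map_smul' c a := by
    simp only [Pi.smul_apply, smul_eq_C_mul, act_mul, act_C, RingHom.id_apply, Finset.smul_sum]

theorem evalAt_X_smul (E : DrinfeldModule F L) {ℓ : ℕ} (P : Fin ℓ → L) (a : Fin ℓ → F[X]) :
    E.evalAt P ((X : F[X]) • a) = E.actX (E.evalAt P a) := by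
  change ∑ i, E.act (((X : F[X]) • a) i) (P i) = E.actX (∑ i, E.act (a i) (P i))
  rw [map_sum]
  refine Finset.sum_congr rfl fun i _ => ?_
  rw [Pi.smul_apply, smul_eq_mul, act_mul]
  rfl

theorem smul_mem_relations (E : DrinfeldModule F L) {ℓ : ℕ} (P : Fin ℓ → L) (p : F[X])
    {a : Fin ℓ → F[X]} (ha : E.evalAt P a = 0) : E.evalAt P (p • a) = 0 := by
  induction p using Polynomial.induction_on' with
  | add p q hp hq => rw [add_smul, map_add, hp, hq, add_zero]
  | monomial n c =>
    rw [← C_mul_X_pow_eq_monomial, mul_smul, ← algebraMap_eq, algebraMap_smul, map_smul]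
    suffices h : E.evalAt P ((X : F[X]) ^ n • a) = 0 by rw [h, smul_zero]
    induction n with
    | zero => rw [pow_zero, one_smul, ha]
    | succ n ih => rw [pow_succ', mul_smul, evalAt_X_smul, ih, map_zero]

/-- The relations between points are generated by those of degree at most the dimension of the
Riemann–Roch space of the bounding divisor. -/
theorem span_relations_eq [IsFunctionField F L] (E : DrinfeldModule F L) {ℓ : ℕ} (hℓ : 0 < ℓ)
    {P : Fin ℓ → L} (hP : ∀ i, P i ≠ 0) :
    (Submodule.span F[X] {a : Fin ℓ → F[X] | a ∈ E.relations P ∧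
      ∀ i, (a i).degree ≤ (Module.finrank F (riemannRochSpace (E.boundDivisor P)) : ℕ)} :
      Set (Fin ℓ → F[X])) = E.relations P := by
  have hfin := finiteDimensional_riemannRochSpace (E.finite_support_boundDivisor hℓ hP)
  refine Set.Subset.antisymm (fun a ha => ?_) fun a ha => ?_
  · change E.evalAt P a = 0
    induction ha using Submodule.span_induction with
    | mem a ha => exact ha.1
    | zero => exact map_zero _
    | add a b _ _ ha hb => rw [map_add, ha, hb, add_zero]
    | smul p a _ ha => exact E.smul_mem_relations P p ha
  · refine mem_span_of_ev_eq_zero (E.evalAt P) E.actX (E.evalAt_X_smul P)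
      (riemannRochSpace (E.boundDivisor P)) (fun a ha => ?_) a ha
    refine E.mem_riemannRochSpace_of_act_X_mem le_sup_right ?_
    have h1 : a = (X : F[X]) • (fun i => (a i).divX) + fun i => C ((a i).coeff 0) := by
      funext i
      simp [X_mul_divX_add]
    -- The constant part contributes an `F`-combination of the `P_i`, so `ev a ∈ 𝓛(D)` gives `φ_t(ev
    -- a') ∈ 𝓛(D)`.
    have h2 : E.evalAt P (fun i => C ((a i).coeff 0)) ∈ riemannRochSpace (E.boundDivisor P) := by
      change ∑ i, E.act (C ((a i).coeff 0)) (P i) ∈ riemannRochSpace (E.boundDivisor P)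
      refine Submodule.sum_mem _ fun i _ => ?_
      rw [act_C]
      exact Submodule.smul_mem _ _ (E.mem_riemannRochSpace_boundDivisor hℓ hP i)
    rw [h1, map_add, evalAt_X_smul] at ha
    exact (Submodule.add_mem_iff_left _ h2).1 ha

/-- An isomorphism is a non-zero constant that twists the coefficients. -/
theorem IsIsomorphism.exists_constant {E E' : DrinfeldModule F L} {u : TwistedPoly F L}
    (hu : IsIsomorphism E E' u) : ∃ c : L, c ≠ 0 ∧ (∀ x, u.eval x = c * x) ∧
      ∀ j, c * E.κ j = E'.κ j * c ^ (Fintype.card F ^ j) := by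
  obtain ⟨hm, u', -, h1, -⟩ := hu
  obtain ⟨c, hc, he⟩ := TwistedPoly.exists_toPoly_eq_of_mul_eq_one h1
  refine ⟨c, hc, fun x => ?_, fun j => ?_⟩
  · rw [TwistedPoly.eval_eq_eval_toPoly, he]; simp
  -- With `u = c`, the morphism condition reads `c φ_t(X) = φ'_t(cX)`; coefficients of `X ^ (q ^ j)`
  -- are compared.
  · have h2 := congrArg (fun w => (TwistedPoly.toPoly w).coeff (Fintype.card F ^ j)) hm
    simp only [TwistedPoly.toPoly_mul, he, comp_C_mul_X_coeff, mul_comp, C_comp, X_comp,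
      coeff_C_mul, TwistedPoly.coeff_toPoly] at h2
    exact h2

end DrinfeldModule

end Drinfeld

end

/-! ### The main theorem -/

theorem theorem1p2 {F : Type*} [Field F] [Fintype F] {L : Type*} [Field L] [Algebra F L]
    [Algebra (RatFunc F) L] [IsScalarTower F (RatFunc F) L] [FiniteDimensional (RatFunc F) L]
    (E : Drinfeld.DrinfeldModule F L) {ℓ : ℕ} (hℓ : 0 < ℓ) (P : Fin ℓ → L)
    (hP : Function.Injective P) (hP0 : ∀ i, P i ≠ 0) :
    -- the formal sums in question are divisors, and the Riemann–Roch space has finite dimension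
    (Function.support (Drinfeld.divVec (F := F) P)).Finite ∧
    (Function.support E.divSlope).Finite ∧
    (Function.support (E.boundDivisor P)).Finite ∧
    FiniteDimensional F (Drinfeld.riemannRochSpace (E.boundDivisor P)) ∧
    -- generators of bounded degree
    (∃ (ν : ℕ) (m : Fin ν → Fin ℓ → Polynomial F),
      (∀ i, m i ∈ E.relations P) ∧
      (Submodule.span (Polynomial F) (Set.range m) : Set (Fin ℓ → Polynomial F))
        = E.relations P ∧
      ∀ i j, (m i j).degree ≤
        ((Module.finrank F (Drinfeld.riemannRochSpace (E.boundDivisor P)) + ℓ : ℕ) :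
          WithBot ℕ)) ∧
    -- the degree of the divisor and the height
    (Module.finrank (RatFunc F) L : ℚ) * Drinfeld.height F P
      ≤ (Drinfeld.deg (E.boundDivisor P) : ℚ) ∧
    (0 ≤ -(Drinfeld.divVec (F := F) P + E.divSlope) →
      (Drinfeld.deg (E.boundDivisor P) : ℚ)
        = (Module.finrank (RatFunc F) L : ℚ) * Drinfeld.height F P) ∧
    -- invariance under isomorphisms
    (∀ (E' : Drinfeld.DrinfeldModule F L) (u : Drinfeld.TwistedPoly F L),
      Drinfeld.DrinfeldModule.IsIsomorphism E E' u →
      (Function.support (E'.boundDivisor fun i => u.eval (P i))).Finite ∧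
      Drinfeld.deg (E'.boundDivisor fun i => u.eval (P i)) = Drinfeld.deg (E.boundDivisor P)) := by
  have : Drinfeld.IsFunctionField F L := Drinfeld.isFunctionField_of_ratFunc
  have hdiv := Drinfeld.finite_support_divVec (F := F) hℓ hP0
  have hbound := E.finite_support_boundDivisor hℓ hP0
  have hheight : (Module.finrank (RatFunc F) L : ℚ) * Drinfeld.height F P
      = (Drinfeld.deg (-Drinfeld.divVec P : Drinfeld.FormalDivisor F L) : ℚ) := by
    have h0 : (Module.finrank (RatFunc F) L : ℚ) ≠ 0 := by
      exact_mod_cast (Module.finrank_pos (R := RatFunc F) (M := L)).ne'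
    rw [Drinfeld.height, mul_div_cancel₀ _ h0, Drinfeld.deg_neg]
    push_cast
    rfl
  refine ⟨hdiv, E.finite_support_divSlope, hbound,
    Drinfeld.finiteDimensional_riemannRochSpace hbound, ?_, ?_, ?_, ?_⟩
  · have hspan := E.span_relations_eq hℓ hP0
    set G := {a : Fin ℓ → Polynomial F | a ∈ E.relations P ∧ ∀ i, (a i).degree ≤
      (Module.finrank F (Drinfeld.riemannRochSpace (E.boundDivisor P)) : ℕ)} with hG
    have hfin : G.Finite := (Drinfeld.finite_degree_le F (Fin ℓ) _).subset fun a ha => ha.2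
    have := hfin.to_subtype
    obtain ⟨ν, ⟨e⟩⟩ := Finite.exists_equiv_fin G
    refine ⟨ν, fun i => (e.symm i : Fin ℓ → Polynomial F), fun i => (e.symm i).2.1, ?_,
      fun i j => ((e.symm i).2.2 j).trans (by exact_mod_cast Nat.le_add_right _ _)⟩
    have hrange : Set.range (fun i => (e.symm i : Fin ℓ → Polynomial F)) = G := by
      rw [← Function.comp_def, e.symm.surjective.range_comp, Subtype.range_coe]
    rw [hrange, hspan]
  · rw [hheight]
    refine Int.cast_le.2 (Drinfeld.deg_mono ?_ hbound le_sup_left)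
    rw [Function.support_neg]
    exact hdiv
  · intro h
    rw [hheight]
    congr 2
    -- Effectivity says `div(E_slope) ≤ -div(P)`, so the maximum is `-div(P)`.
    refine sup_eq_left.2 fun v => ?_
    have hv := h v
    simp only [Pi.zero_apply, Pi.neg_apply, Pi.add_apply] at hv ⊢
    omega
  · intro E' u hu
    obtain ⟨c, hc, heval, hκ⟩ := hu.exists_constant
    have hP0' : ∀ i, u.eval (P i) ≠ 0 := fun i => by
      rw [heval]
      exact mul_ne_zero hc (hP0 i)
    refine ⟨E'.finite_support_boundDivisor hℓ hP0', ?_⟩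
    -- Both terms of the maximum drop by `ord_v(c)`, so `D' = D - div(c)`.
    rw [← Drinfeld.deg_sub_ordInt hbound c]
    congr 1
    funext v
    simp only [heval]
    change max (-Drinfeld.divVec (fun i => c * P i) v) (E'.divSlope v)
      = max (-Drinfeld.divVec P v) (E.divSlope v) - v.ordInt c
    rw [Drinfeld.divVec_mul hℓ hP0 hc, E.divSlope_eq_sub E' hc hκ]
    omega
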